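/- Let $p$ be an odd prime, $m\ge 1$ an integer and $k,\ell\ge 0$ integers, and put $u=\gcd(k,m)$, $v=\gcd(\ell,m)$. Let $\mathrm{Tr}$ be the trace from $\mathbb F_{p^m}$ to $\mathbb F_p$, let $\eta$ be the quadratic character of $\mathbb F_p$ (with $\eta(0)=0$), and let $v_2$ be the 2-adic valuation. For $c\in\mathbb F_p$ let $$D=\{(x,y)\in\mathbb F_{p^m}^2\setminus\{(0,0)\}:\ \mathrm{Tr}(x^{p^k+1}+y^{p^\ell+1})=c\},\qquad \mathcal C_D=\{(\mathrm{Tr}(ax+by))_{(x,y)\in D}:\ a,b\in\mathbb F_{p^m}\}.$$ For a linear code $\mathcal C$ of length $n$ over $\mathbb F_p$, let $A_i$ be the number of codewords of Hamming weight $i$. The weight enumerator of $\mathcal C$ is $1+A_1x+\dots+A_nx^n$, the code is a $t$-weight code if exactly $t$ of $A_1,\dots,A_n$ are nonzero, and it is an $[n,\kappa]$ code if its dimension is $\kappa$. The complete weight enumerator of $\mathcal C$ is $\sum_{\mathbf c\in\mathcal C}\prod_{\rho\in\mathbb F_p}w_\rho^{k_\rho(\mathbf c)}$, where $k_\rho(\mathbf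 c)$ is the number of components of $\mathbf c$ equal to $\rho$. Assume $2v_2(m)=v_2(u)+v_2(v)+1$ (so $m$ is even), and put $\varepsilon=(-1)^{(p-1)m/4}$ and $\varepsilon'=(-1)^{(p-1)(m+2)/4}$. (1) If $c=0$, then $\mathcal C_D$ is a two-weight $[p^{2m-1}+\varepsilon(p-1)p^{m-1}-1,\,2m]$ linear code with weight enumerator $$1+\bigl(p^{2m-1}+\varepsilon(p-1)p^{m-1}-1\bigr)x^{(p-1)p^{2m-2}}+(p-1)\bigl(p^{2m-1}-\varepsilon p^{m-1}\bigr)x^{(p-1)(p^{2m-2}+\varepsilon p^{m-1})}$$ and complete weight enumerator $$w_0^{p^{2m-1}+\varepsilon(p-1)p^{m-1}-1}+\bigl(p^{2m-1}+\varepsilon(p-1)p^{m-1}-1\bigr)w_0^{p^{2m-2}+\varepsilon(p-1)p^{m-1}-1}\prod_{\rho\in\mathbb F_p^*}w_\rho^{p^{2m-2}}+(p-1)\bigl(p^{2m-1}-\varepsilon p^{m-1}\bigr)w_0^{p^{2m-2}-1}\prod_{\rho\in\mathbb F_p^*}w_\rho^{p^{2m-2}+\varepsilon p^{m-1}}.$$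 (2) If $c\in\mathbb F_p^*$, then $\mathcal C_D$ is a two-weight $[p^{2m-1}-\varepsilon p^{m-1},\,2m]$ linear code with weight enumerator $$1+\Bigl(\tfrac{p+1}2p^{2m-1}+\tfrac{p-1}2\varepsilon p^{m-1}-1\Bigr)x^{(p-1)p^{2m-2}}+\tfrac{p-1}2\bigl(p^{2m-1}-\varepsilon p^{m-1}\bigr)x^{(p-1)p^{2m-2}-2\varepsilon p^{m-1}}$$ and, for every generator $g$ of $\mathbb F_p^*$, complete weight enumerator $$w_0^{p^{2m-1}-\varepsilon p^{m-1}}+\bigl(p^{2m-1}+\varepsilon(p-1)p^{m-1}-1\bigr)w_0^{p^{2m-2}-\varepsilon p^{m-1}}\prod_{\rho\in\mathbb F_p^*}w_\rho^{p^{2m-2}}$$ $$+\bigl(p^{2m-1}-\varepsilon p^{m-1}\bigr)\Biggl(\sum_{j=1}^{(p-1)/2}w_0^{p^{2m-2}+\varepsilon'p^{m-1}}\,w_{2g^j}^{p^{2m-2}}\,w_{-2g^j}^{p^{2m-2}}\prod_{\rho\in\mathbb F_p^*,\ \rho\ne\pm2g^j}w_\rho^{p^{2m-2}+\varepsilon p^{m-1}\eta(\rho^2-4g^{2j})}+\sum_{j=1}^{(p-1)/2}w_0^{p^{2m-2}-\varepsilon'p^{m-1}}\prod_{\rho\in\mathbb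 F_p^*}w_\rho^{p^{2m-2}+\varepsilon p^{m-1}\eta(\rho^2-4g^{2j+1})}\Biggr).$$ -/

import Mathlib

open Polynomial

/-! Linear codes of length `|ι|` over a finite field `K`, with coordinates indexed by `ι`. -/

section Codes

variable {K ι : Type*} [Field K] [Fintype K] [DecidableEq K] [Fintype ι]

/-- The number `A_i` of codewords of Hamming weight `i` in the linear code `C`. -/
noncomputable def weightCount (C : Submodule K (ι → K)) (i : ℕ) : ℕ :=
  Nat.card {w : ι → K // w ∈ C ∧ hammingNorm w = i}

/-- The weight enumerator `1 + A_1 x + A_2 x^2 + ... + A_n x^n` of a code of length `n`. -/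
noncomputable def weightEnumerator (C : Submodule K (ι → K)) : ℤ[X] :=
  1 + ∑ i ∈ Finset.Icc 1 (Fintype.card ι), Polynomial.C (weightCount C i : ℤ) * X ^ i

/-- A `t`-weight code: exactly `t` of the numbers `A_1, ..., A_n` are nonzero. -/
def IsWeightCode (C : Submodule K (ι → K)) (t : ℕ) : Prop :=
  {i : ℕ | 1 ≤ i ∧ i ≤ Fintype.card ι ∧ weightCount C i ≠ 0}.ncard = t

/-- The number `k_ρ(w)` of components of the vector `w` that are equal to `ρ`. -/
def symbolCount (w : ι → K) (ρ : K) : ℕ :=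
  (Finset.univ.filter fun i => w i = ρ).card

open Classical in
/-- The complete weight enumerator of `C`: the sum over all codewords `w` of the monomial
`∏ ρ, w_ρ ^ k_ρ(w)`; the variables are indexed by the elements of the field. -/
noncomputable def completeWeightEnumerator (C : Submodule K (ι → K)) : MvPolynomial K ℤ :=
  ∑ w ∈ Finset.univ.filter (fun w : ι → K => w ∈ C),
    ∏ ρ : K, MvPolynomial.X ρ ^ symbolCount w ρ

end Codes

section DefiningSet

variable (p : ℕ) [Fact p.Prime] {F : Type*} [Field F] [Algebra (ZMod p) F]

/-- The code `{ (Tr(a x + b y))_{(x, y) ∈ D} : a, b ∈ F }` over `F_p` with defining set `D`. -/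
noncomputable def codeOf (D : Finset (F × F)) : Submodule (ZMod p) (D → ZMod p) where
  carrier := {w | ∃ a b : F,
    w = fun d : D => Algebra.trace (ZMod p) F (a * (d : F × F).1 + b * (d : F × F).2)}
  add_mem' := by
    rintro _ _ ⟨a, b, rfl⟩ ⟨a', b', rfl⟩
    refine ⟨a + a', b + b', ?_⟩
    funext d
    simp only [Pi.add_apply, ← map_add]
    congr 1
    ring
  zero_mem' := ⟨0, 0, by funext d; simp⟩
  smul_mem' := by
    rintro r _ ⟨a, b, rfl⟩
    refine ⟨r • a, r • b, ?_⟩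
    funext d
    simp only [Pi.smul_apply, ← map_smul, smul_add, smul_mul_assoc]

/-- The set `D` of all `(x, y) ≠ (0, 0)` in `F²` with `Tr(x^(p^k+1) + y^(p^ℓ+1)) = c`. -/
noncomputable def definingSet [Fintype F] [DecidableEq F] (k l : ℕ) (c : ZMod p) :
    Finset (F × F) :=
  Finset.univ.filter fun d =>
    d ≠ (0, 0) ∧ Algebra.trace (ZMod p) F (d.1 ^ (p ^ k + 1) + d.2 ^ (p ^ l + 1)) = c

end DefiningSet

/-! ### Counting solutions of quadratic equations by additive characters -/

section QuadraticSpace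

variable {p : ℕ} [Fact p.Prime] {V : Type*} [AddCommGroup V] [Module (ZMod p) V] [Fintype V]

/-! Put `Q (x, y) = Tr (x^(p^k+1) + y^(p^l+1))`, a quadratic form on a space of dimension `2m` over
`F_p`. Its polar form `B` is nondegenerate, so the codewords are exactly the functionals `B (·, w)`
restricted to `D`, and the code is governed by the numbers of `v` with `Q v = c` and `B (v, w) = ρ`.
If `∑ ψ (t Q v) = ε p^m` for every `t ≠ 0`, with `ε` independent of `t`, then orthogonality of
characters and completion of the square express these numbers through the roots of `s² Q w + s ρ +
c` in `F_p` (`mul_sliceCount`). A nonzero codeword's symbol counts therefore depend on `Q w` alone,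
and both enumerators follow by summing over the values of `Q` (`IsPolarCode.sum_code`).

The real work is the evaluation of the exponential sum, which factors over the two variables. As
`v_2(u), v_2(v) ≤ v_2(m)`, the valuation hypothesis makes one of them equal to `v_2(m)` and the
other one less.

In the deficient case all nonzero values of the form are equally frequent, so the sum is an integer
`S` with `S² = p^m`; counting the nonzero arguments in cosets of a group of roots of unity gives `S
≡ 1` modulo `p^e + 1`, which selects `S = -p^(m/2)` (`sum_addChar_tracePowForm_of_odd`).

In the full case `x^(p^k+1)` is distributed like `x²` (`sum_comp_pow_eq_sum_comp_sq`). With `m =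
2n`, the form `Tr (x²)` is either equivalent to `Tr (x^(p^n+1))`, when `p^n ≡ 1` mod 4, which is a
deficient case again, or visibly hyperbolic, when `p^n ≡ 3`. The sum is `-ε p^(m/2)`, and the
product of the two factors is `ε p^m`. -/

theorem sum_addChar_mul {ψ : AddChar (ZMod p) ℂ} (hψ : ψ.IsPrimitive) (a : ZMod p) :
    ∑ t, ψ (t * a) = if a = 0 then (p : ℂ) else 0 := by
  rw [AddChar.sum_mulShift a hψ, ZMod.card]
  split_ifs <;> simp

theorem sum_addChar_linear_eq_zero {ψ : AddChar (ZMod p) ℂ} (hψ : ψ.IsPrimitive)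
    (f : V →ₗ[ZMod p] ZMod p) (hf : f ≠ 0) : ∑ v, ψ (f v) = 0 := by
  have h := AddChar.sum_eq_zero_of_ne_one (ψ := ψ.compAddMonoidHom f.toAddMonoidHom) ?_
  · simpa using h
  · obtain ⟨v, hv⟩ : ∃ v, f v ≠ 0 := by
      by_contra! h
      exact hf (LinearMap.ext h)
    intro h
    have h1 := hψ hv
    apply h1
    ext t
    have := DFunLike.congr_fun h (t • v)
    simpa [AddChar.mulShift_apply, mul_comm] using this

/-- The number of vectors on which a quadratic form takes the value `c`. -/
noncomputable def valueCount (Q : QuadraticForm (ZMod p) V) (c : ZMod p) : ℕ :=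
  Nat.card {v : V // Q v = c}

/-- The number of vectors `v` with `Q v = c` and `B (v, w) = ρ`, for the polar form `B` of `Q`. -/
noncomputable def sliceCount (Q : QuadraticForm (ZMod p) V) (w : V) (c ρ : ZMod p) : ℕ :=
  Nat.card {v : V // Q v = c ∧ QuadraticMap.polar Q v w = ρ}

/-- The number of roots of `A s ^ 2 + ρ s + c`. -/
noncomputable def rootCount (A ρ c : ZMod p) : ℕ :=
  Nat.card {s : ZMod p // c + s * ρ + s ^ 2 * A = 0}

theorem natCard_subtype_eq_sum {α : Type*} [Fintype α] (P : α → Prop) [DecidablePred P] :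
    (Nat.card {a // P a} : ℂ) = ∑ a, if P a then (1 : ℂ) else 0 := by
  rw [Nat.card_eq_fintype_card, Fintype.card_subtype, Finset.sum_boole]

variable {Q : QuadraticForm (ZMod p) V} {ψ : AddChar (ZMod p) ℂ} {ε : ℤ} {m : ℕ}

theorem sum_ne_zero_addChar_mul (hψ : ψ.IsPrimitive) (a : ZMod p) :
    ∑ t with t ≠ 0, ψ (t * a) = (if a = 0 then (p : ℂ) else 0) - 1 := by
  rw [← sum_addChar_mul hψ, Finset.filter_ne', ← Finset.add_sum_erase _ _ (Finset.mem_univ 0)]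
  simp

theorem sum_eq_zero_term_add {M : Type*} [AddCommGroup M] (f : ZMod p → M) :
    ∑ t, f t = f 0 + ∑ t with t ≠ 0, f t := by
  rw [Finset.filter_ne', Finset.add_sum_erase _ _ (Finset.mem_univ 0)]

theorem mul_valueCount (hψ : ψ.IsPrimitive) (hV : Fintype.card V = p ^ (2 * m))
    (hT : ∀ t : ZMod p, t ≠ 0 → ∑ v, ψ (t * Q v) = ε * (p : ℂ) ^ m) (c : ZMod p) :
    (p : ℤ) * valueCount Q c
      = (p : ℤ) ^ (2 * m) + ε * (p : ℤ) ^ m * ((if c = 0 then (p : ℤ) else 0) - 1) := by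
  have key : (p : ℂ) * valueCount Q c
      = (p : ℂ) ^ (2 * m) + ε * (p : ℂ) ^ m * ((if c = 0 then (p : ℂ) else 0) - 1) := by
    classical
    rw [valueCount, natCard_subtype_eq_sum, Finset.mul_sum]
    have h1 : ∀ v, (p : ℂ) * (if Q v = c then 1 else 0) = ∑ t, ψ (t * -c) * ψ (t * Q v) := by
      intro v
      have := sum_addChar_mul hψ (Q v - c)
      simp only [sub_eq_zero] at this
      rw [mul_ite, mul_one, mul_zero, ← this]
      refine Finset.sum_congr rfl fun t _ => ?_
      rw [← AddChar.map_add_eq_mul]; congr 1; ring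
    rw [Finset.sum_congr rfl fun v _ => h1 v, Finset.sum_comm, sum_eq_zero_term_add]
    congr 1
    · simp [hV]
    · have : ∀ t ∈ Finset.univ.filter (fun t : ZMod p => t ≠ 0),
          ∑ v, ψ (t * -c) * ψ (t * Q v) = ψ (t * -c) * (ε * (p : ℂ) ^ m) := by
        intro t ht
        rw [← Finset.mul_sum, hT t (by simpa using ht)]
      rw [Finset.sum_congr rfl this, ← Finset.sum_mul, sum_ne_zero_addChar_mul hψ, mul_comm]
      simp
  refine Int.cast_injective (α := ℂ) ?_
  push_cast [apply_ite (Int.cast : ℤ → ℂ)]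
  exact key

theorem mul_sliceCount (hψ : ψ.IsPrimitive) (hV : Fintype.card V = p ^ (2 * m))
    (hT : ∀ t : ZMod p, t ≠ 0 → ∑ v, ψ (t * Q v) = ε * (p : ℂ) ^ m)
    {w : V} (hw : ∃ v, QuadraticMap.polar Q v w ≠ 0) (c ρ : ZMod p) :
    (p : ℤ) ^ 2 * sliceCount Q w c ρ
      = (p : ℤ) ^ (2 * m) + ε * (p : ℤ) ^ (m + 1) * (rootCount (Q w) ρ c - 1) := by
  have key : (p : ℂ) ^ 2 * sliceCount Q w c ρ
      = (p : ℂ) ^ (2 * m) + ε * (p : ℂ) ^ (m + 1) * (rootCount (Q w) ρ c - 1) := by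
    classical
    rw [sliceCount, natCard_subtype_eq_sum, Finset.mul_sum]
    have h1 : ∀ v, (p : ℂ) ^ 2 * (if Q v = c ∧ QuadraticMap.polar Q v w = ρ then 1 else 0)
        = ∑ t, ∑ s, ψ (t * (Q v - c)) * ψ (s * (QuadraticMap.polar Q v w - ρ)) := by
      intro v
      rw [← Finset.sum_mul_sum, sum_addChar_mul hψ, sum_addChar_mul hψ]
      by_cases h1 : Q v = c <;> by_cases h2 : QuadraticMap.polar Q v w = ρ <;>
        simp [h1, h2, sub_eq_zero, sq]
    rw [Finset.sum_congr rfl fun v _ => h1 v, Finset.sum_comm, sum_eq_zero_term_add]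
    congr 1
    -- For `t = 0` only `s = 0` survives, because `v ↦ B (v, w)` is a nonzero functional.
    · rw [Finset.sum_comm, sum_eq_zero_term_add]
      have : ∀ s ∈ Finset.univ.filter (fun s : ZMod p => s ≠ 0),
          ∑ v, ψ (0 * (Q v - c)) * ψ (s * (QuadraticMap.polar Q v w - ρ)) = 0 := by
        intro s hs
        have hs : s ≠ 0 := by simpa using hs
        have h3 : ∑ v, ψ ((s • (QuadraticMap.polarBilin Q).flip w) v) = 0 := by
          refine sum_addChar_linear_eq_zero hψ _ fun h => ?_
          obtain ⟨v, hv⟩ := hw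
          have := LinearMap.congr_fun h v
          simp [hs, hv] at this
        have h4 : ∀ v, ψ (0 * (Q v - c)) * ψ (s * (QuadraticMap.polar Q v w - ρ))
            = ψ ((s • (QuadraticMap.polarBilin Q).flip w) v) * ψ (- (s * ρ)) := by
          intro v
          rw [← AddChar.map_add_eq_mul, ← AddChar.map_add_eq_mul]
          congr 1
          simp
          ring
        rw [Finset.sum_congr rfl fun v _ => h4 v, ← Finset.sum_mul, h3, zero_mul]
      rw [Finset.sum_eq_zero this]
      simp [hV]
    · have : ∀ t ∈ Finset.univ.filter (fun t : ZMod p => t ≠ 0),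
          ∑ v, ∑ s, ψ (t * (Q v - c)) * ψ (s * (QuadraticMap.polar Q v w - ρ))
            = (ε * (p : ℂ) ^ m) * ∑ s, ψ (t * -(c + s * ρ + s ^ 2 * Q w)) := by
        intro t ht
        have ht : t ≠ 0 := by simpa using ht
        -- After `s` is replaced by `t s`, the exponent completes to `t Q (v + s w) - t s² Q w`, and
        -- translation by `s w` removes `s` from the sum over `v`.
        rw [Finset.sum_comm, ← Equiv.sum_comp (Equiv.mulLeft₀ t ht), Finset.mul_sum]
        refine Finset.sum_congr rfl fun s _ => ?_
        rw [← hT t ht, ← Equiv.sum_comp (Equiv.addRight (s • w)) fun v => ψ (t * Q v),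
          Finset.sum_mul]
        refine Finset.sum_congr rfl fun v _ => ?_
        rw [← AddChar.map_add_eq_mul, ← AddChar.map_add_eq_mul]
        congr 1
        have h5 : Q (v + s • w) = Q v + s * s * Q w + s * QuadraticMap.polar Q v w := by
          rw [QuadraticMap.map_add Q, QuadraticMap.map_smul, QuadraticMap.polar_smul_right]
          rfl
        change t * (Q v - c) + t * s * (QuadraticMap.polar Q v w - ρ)
          = t * Q (v + s • w) + t * -(c + s * ρ + s ^ 2 * Q w)
        rw [h5]
        ring
      rw [Finset.sum_congr rfl this, ← Finset.mul_sum, Finset.sum_comm]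
      have h5 : ∀ s : ZMod p, ∑ t with t ≠ 0, ψ (t * -(c + s * ρ + s ^ 2 * Q w))
          = p * (if c + s * ρ + s ^ 2 * Q w = 0 then 1 else 0) - 1 := by
        intro s
        rw [sum_ne_zero_addChar_mul hψ, mul_ite, mul_one, mul_zero]
        simp only [neg_eq_zero]
      rw [Finset.sum_congr rfl fun s _ => h5 s, Finset.sum_sub_distrib, ← Finset.mul_sum,
        ← natCard_subtype_eq_sum, rootCount]
      simp [ZMod.card]
      ring
  exact_mod_cast key

/-- For a form with nondegenerate polar form, the two conjugate exponential sums multiply to the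
number of vectors. -/
theorem sum_addChar_mul_sum_addChar_neg (hψ : ψ.IsPrimitive)
    (hQ : ∀ w, (∀ v, QuadraticMap.polar Q v w = 0) → w = 0) {t : ZMod p} (ht : t ≠ 0) :
    (∑ v, ψ (t * Q v)) * ∑ v, ψ (-t * Q v) = Fintype.card V := by
  classical
  rw [mul_comm, Finset.sum_mul_sum]
  have h : ∀ v, ∑ w, ψ (-t * Q v) * ψ (t * Q w)
      = ∑ w, ψ (t * Q w) * ψ ((t • (QuadraticMap.polarBilin Q).flip w) v) := by
    intro v
    -- With `v + w` in place of `w`, the difference `Q (v + w) - Q v` is affine in `v`, so the sum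
    -- over `v` vanishes unless `w` is in the radical.
    rw [← Equiv.sum_comp (Equiv.addLeft v)]
    refine Finset.sum_congr rfl fun w _ => ?_
    rw [← AddChar.map_add_eq_mul, ← AddChar.map_add_eq_mul]
    congr 1
    change -t * Q v + t * Q (v + w) = t * Q w + t * QuadraticMap.polar Q v w
    rw [QuadraticMap.map_add Q]
    ring
  rw [Finset.sum_congr rfl fun v _ => h v, Finset.sum_comm, Finset.sum_eq_single 0]
  · simp
  · intro w _ hw
    rw [← Finset.mul_sum, sum_addChar_linear_eq_zero hψ, mul_zero]
    intro h
    refine hw (hQ w fun v => ?_)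
    have := LinearMap.congr_fun h v
    simpa [ht] using this
  · simp

end QuadraticSpace

/-! ### The forms `Tr (x^(p^k+1))`: nondegeneracy and the deficient exponential sum -/

section FrobeniusForms

variable {p : ℕ} [Fact p.Prime] {F : Type*} [Field F] [Fintype F] [Algebra (ZMod p) F]

/-- The automorphism `x ↦ x ^ p ^ k`. -/
noncomputable def frobPow (p : ℕ) [Fact p.Prime] (F : Type*) [Field F] [Fintype F]
    [Algebra (ZMod p) F] (k : ℕ) : F ≃ₐ[ZMod p] F :=
  FiniteField.frobeniusAlgEquivOfAlgebraic (ZMod p) F ^ k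

theorem frobPow_apply (k : ℕ) (x : F) : frobPow p F k x = x ^ p ^ k := by
  rw [frobPow, AlgEquiv.coe_pow, FiniteField.coe_frobeniusAlgEquivOfAlgebraic_iterate, ZMod.card]

theorem trace_pow (k : ℕ) (x : F) :
    Algebra.trace (ZMod p) F (x ^ p ^ k) = Algebra.trace (ZMod p) F x := by
  rw [← frobPow_apply, Algebra.trace_eq_of_algEquiv]

theorem eq_zero_of_trace_mul {a : F} (h : ∀ x, Algebra.trace (ZMod p) F (a * x) = 0) : a = 0 :=
  (traceForm_nondegenerate (ZMod p) F).1 a h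

theorem pow_pow_eq_self_of_dvd {K : Type*} [Field K] [Fintype K] {q m n : ℕ}
    (hK : Fintype.card K = q ^ m) (h : m ∣ n) (x : K) : x ^ q ^ n = x := by
  obtain ⟨j, rfl⟩ := h
  rw [pow_mul, ← hK, FiniteField.pow_card_pow]

/-- The quadratic form `Tr (x ^ (p ^ k + 1))`. -/
noncomputable def tracePowForm (p : ℕ) [Fact p.Prime] (F : Type*) [Field F] [Fintype F]
    [Algebra (ZMod p) F] (k : ℕ) : QuadraticForm (ZMod p) F :=
  LinearMap.BilinMap.toQuadraticMap
    ((Algebra.traceForm (ZMod p) F).compl₁₂ (frobPow p F k).toLinearMap LinearMap.id)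

theorem tracePowForm_apply (k : ℕ) (x : F) :
    tracePowForm p F k x = Algebra.trace (ZMod p) F (x ^ (p ^ k + 1)) := by
  simp [tracePowForm, frobPow_apply, Algebra.traceForm_apply, pow_succ]

theorem polar_tracePowForm (k : ℕ) (v w : F) :
    QuadraticMap.polar (tracePowForm p F k) v w
      = Algebra.trace (ZMod p) F (v ^ p ^ k * w) + Algebra.trace (ZMod p) F (w ^ p ^ k * v) := by
  simp [tracePowForm, LinearMap.BilinMap.polar_toQuadraticMap, frobPow_apply,
    Algebra.traceForm_apply]

theorem two_ne_zero_of_odd {K : Type*} [Field K] [Algebra (ZMod p) K] (hp : p ≠ 2) :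
    (2 : K) ≠ 0 := by
  have := charP_of_injective_algebraMap (algebraMap (ZMod p) K).injective p
  exact Ring.two_ne_zero (by rwa [ringChar.eq K p])

/-- If `w` is in the radical, moving the Frobenius power across the trace gives `w^(p^(2k)) = -w`.
Iterating this an odd number `j` of times with `m ∣ 2kj` returns to `w`, so `w = -w`. -/
theorem polar_tracePowForm_nondegenerate (hp : p ≠ 2) {m k j : ℕ}
    (hF : Fintype.card F = p ^ m) (hj : Odd j) (hm : m ∣ 2 * k * j) (w : F)
    (h : ∀ v, QuadraticMap.polar (tracePowForm p F k) v w = 0) : w = 0 := by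
  obtain ⟨u, hu⟩ := (frobPow p F k).surjective w
  rw [frobPow_apply] at hu
  have h1 : u + w ^ p ^ k = 0 := by
    refine eq_zero_of_trace_mul (p := p) fun v => ?_
    have := h v
    rw [polar_tracePowForm, ← hu, ← mul_pow, trace_pow, hu, ← map_add] at this
    rw [← this]
    congr 1
    ring
  have h2 : w ^ p ^ (2 * k) = -w := by
    rw [eq_neg_of_add_eq_zero_left h1, ← frobPow_apply, map_neg, frobPow_apply, ← pow_mul,
      ← pow_add, ← two_mul] at hu
    exact neg_eq_iff_eq_neg.1 hu
  have h3 : ∀ n, w ^ p ^ (2 * k * n) = (-1) ^ n * w := by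
    intro n
    induction n with
    | zero => simp
    | succ n ih =>
      rw [mul_add, mul_one, pow_add, pow_mul, ih, ← frobPow_apply, map_mul, map_pow, map_neg,
        map_one, frobPow_apply, h2]
      ring
  have h4 := h3 j
  rw [pow_pow_eq_self_of_dvd hF hm, hj.neg_one_pow] at h4
  have h5 : (2 : F) * w = 0 := by linear_combination h4
  exact (mul_eq_zero.1 h5).resolve_left (two_ne_zero_of_odd (p := p) hp)

/-- A set of elements of a finite group that is stable under a subgroup has a cardinality divisible
by the order of the subgroup. -/
theorem card_dvd_natCard_of_mul_mem {G : Type*} [Group G] (H : Subgroup G) (S : Set G)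
    (hS : ∀ x ∈ S, ∀ h ∈ H, x * h ∈ S) : Nat.card H ∣ Nat.card S := by
  have h : (QuotientGroup.mk : G → G ⧸ H) ⁻¹' (QuotientGroup.mk '' S) = S := by
    refine Set.Subset.antisymm ?_ (Set.subset_preimage_image _ _)
    rintro x ⟨y, hy, hxy⟩
    have := hS y hy _ (QuotientGroup.eq.1 hxy)
    simpa using this
  rw [← h, Nat.card_congr (QuotientGroup.preimageMkEquivSubgroupProdSet H _), Nat.card_prod]
  exact dvd_mul_right _ _

theorem sum_comp_eq_sum_valueCount (Q : QuadraticForm (ZMod p) F) (f : ZMod p → ℂ) :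
    ∑ x, f (Q x) = ∑ c, valueCount Q c * f c := by
  classical
  rw [← Finset.sum_fiberwise Finset.univ Q]
  refine Finset.sum_congr rfl fun c _ => ?_
  rw [valueCount, Nat.card_eq_fintype_card, Fintype.card_subtype, ← nsmul_eq_mul,
    ← Finset.sum_const]
  exact Finset.sum_congr rfl fun x hx => by rw [(Finset.mem_filter.1 hx).2]

theorem natCard_units_pow_eq_one {N : ℕ} (hN : N ∣ Fintype.card F - 1) :
    Nat.card (powMonoidHom (α := Fˣ) N).ker = N := by
  classical
  rw [IsCyclic.card_powMonoidHom_ker, Nat.card_eq_fintype_card, Fintype.card_units]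
  exact Nat.gcd_eq_right hN

/-- Multiplying `x` by an `N`-th root of unity does not change `x^n`, and there are `N` such roots,
so the solutions form a union of cosets. -/
theorem dvd_natCard_pow_eq {N n : ℕ} (hN : N ∣ Fintype.card F - 1) (hn : N ∣ n)
    (P : F → Prop) : N ∣ Nat.card {x : Fˣ // P ((x : F) ^ n)} := by
  have := card_dvd_natCard_of_mul_mem (powMonoidHom (α := Fˣ) N).ker {x | P ((x : F) ^ n)} ?_
  · rwa [natCard_units_pow_eq_one hN] at this
  · intro x hx h hh
    have hh : h ^ N = 1 := by simpa using hh
    obtain ⟨d, rfl⟩ := hn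
    have : ((h : F)) ^ N = 1 := by simpa using congrArg Units.val hh
    simpa [mul_pow, pow_mul, this] using hx

theorem valueCount_eq_natCard_units (Q : QuadraticForm (ZMod p) F) (c : ZMod p) :
    valueCount Q c = Nat.card {x : Fˣ // Q x = c} + if c = 0 then 1 else 0 := by
  classical
  have h1 : Nat.card {x : Fˣ // Q x = c}
      = (Finset.univ.filter fun x : F => x ≠ 0 ∧ Q x = c).card := by
    rw [Nat.card_eq_fintype_card, Fintype.card_subtype]
    refine Finset.card_bij (fun x _ => (x : F)) ?_ ?_ ?_
    · intro x hx
      simpa using hx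
    · intro x _ y _ h
      exact Units.ext h
    · intro x hx
      simp only [Finset.mem_filter, Finset.mem_univ, true_and] at hx
      exact ⟨Units.mk0 x hx.1, by simpa using hx.2, rfl⟩
  rw [h1, valueCount, Nat.card_eq_fintype_card, Fintype.card_subtype]
  split_ifs with hc
  · subst hc
    have : (Finset.univ.filter fun x : F => Q x = 0)
        = insert 0 (Finset.univ.filter fun x : F => x ≠ 0 ∧ Q x = 0) := by
      ext x
      by_cases hx : x = 0 <;> simp [hx]
    rw [this, Finset.card_insert_of_notMem (by simp)]
  · rw [add_zero]
    congr 1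
    ext x
    simp only [Finset.mem_filter, Finset.mem_univ, true_and]
    refine ⟨fun h => ⟨?_, h⟩, fun h => h.2⟩
    rintro rfl
    exact hc (by rw [← h, map_zero])

/-- Every element of the prime field is a `(p ^ k + 1)`-th power if the `2`-adic valuation of `k`
is one less than that of the degree. -/
theorem exists_pow_eq_algebraMap {e k s : ℕ} (hk : Odd k)
    (hF : Fintype.card F = p ^ (2 * e * s)) {c : ZMod p} (hc : c ≠ 0) :
    ∃ z : F, z ≠ 0 ∧ z ^ (p ^ (e * k) + 1) = algebraMap (ZMod p) F c := by
  classical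
  have hp1 := (Fact.out : p.Prime).two_le
  have hd : (p - 1) * (p ^ e + 1) ∣ p ^ (2 * e) - 1 := by
    have h1 : p ^ (2 * e) - 1 = (p ^ e - 1) * (p ^ e + 1) := by
      rw [mul_comm 2 e, pow_mul, mul_comm (p ^ e - 1), ← Nat.sq_sub_sq, one_pow]
    rw [h1]
    refine mul_dvd_mul_right ?_ _
    simpa using Nat.sub_dvd_pow_sub_pow p 1 e
  have hq : (p - 1) * (p ^ e + 1) ∣ Fintype.card F - 1 := by
    refine hd.trans ?_
    rw [hF, pow_mul p (2 * e) s]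
    simpa using Nat.sub_dvd_pow_sub_pow (p ^ (2 * e)) 1 s
  obtain ⟨g, hg⟩ := IsCyclic.exists_generator (α := Fˣ)
  have hca : algebraMap (ZMod p) F c ≠ 0 := by simpa using hc
  obtain ⟨j, hj⟩ := Submonoid.mem_powers_iff _ _ |>.1
    (mem_powers_iff_mem_zpowers.2 (hg (Units.mk0 _ hca)))
  have hj' : (g : F) ^ j = algebraMap (ZMod p) F c := by
    simpa using congrArg Units.val hj
  have hord : orderOf g = Fintype.card F - 1 := by
    rw [orderOf_eq_card_of_forall_mem_zpowers hg, Nat.card_eq_fintype_card, Fintype.card_units]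
  have hj1 : g ^ (j * (p - 1)) = 1 := by
    apply Units.ext
    rw [Units.val_pow_eq_pow_val, pow_mul, hj', ← map_pow, ZMod.pow_card_sub_one_eq_one hc]
    simp
  -- The order of `g` is divisible by `(p - 1)(p^e + 1)`, while `g^j` lies in the prime field and so
  -- has order dividing `p - 1`.
  have hjd : p ^ e + 1 ∣ j := by
    have h1 : (p - 1) * (p ^ e + 1) ∣ (p - 1) * j := by
      rw [mul_comm _ j]
      exact hq.trans (hord ▸ orderOf_dvd_of_pow_eq_one hj1)
    exact Nat.dvd_of_mul_dvd_mul_left (by omega) h1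
  obtain ⟨i, rfl⟩ := hjd
  refine ⟨(g : F) ^ i, pow_ne_zero _ g.ne_zero, ?_⟩
  have hz1 : ((g : F) ^ i) ^ (p ^ e + 1) = algebraMap (ZMod p) F c := by
    rw [← hj', ← pow_mul, mul_comm]
  -- The element lies in the subfield of order `p^(2e)`, on which the powers `p^(ek)` and `p^e`
  -- agree because `k` is odd.
  have hz2 : ((g : F) ^ i) ^ p ^ (2 * e) = (g : F) ^ i := by
    have h1 : ((g : F) ^ i) ^ (p ^ (2 * e) - 1) = 1 := by
      obtain ⟨r, hr⟩ := hd
      rw [hr, mul_comm (p - 1), mul_assoc, pow_mul, hz1, pow_mul, ← map_pow,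
        ZMod.pow_card_sub_one_eq_one hc]
      simp
    have h2 : p ^ (2 * e) = p ^ (2 * e) - 1 + 1 :=
      (Nat.sub_add_cancel (Nat.one_le_pow _ _ (by omega))).symm
    rw [h2, pow_succ, h1, one_mul]
  obtain ⟨r, rfl⟩ := hk
  have hz3 : ∀ n, ((g : F) ^ i) ^ p ^ (2 * e * n) = (g : F) ^ i := by
    intro n
    induction n with
    | zero => simp
    | succ n ih => rw [mul_add, mul_one, pow_add, pow_mul, ih, hz2]
  rw [← hz1, pow_succ, pow_succ, show e * (2 * r + 1) = 2 * e * r + e by ring, pow_add p, pow_mul,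
    hz3]

/-- Scaling `x` by `z` with `z^(p^(ek)+1) = c` multiplies the form by `c`. -/
theorem valueCount_eq_valueCount_one {e k s : ℕ} (hk : Odd k)
    (hF : Fintype.card F = p ^ (2 * e * s)) {c : ZMod p} (hc : c ≠ 0) :
    valueCount (tracePowForm p F (e * k)) c = valueCount (tracePowForm p F (e * k)) 1 := by
  obtain ⟨z, hz, hzc⟩ := exists_pow_eq_algebraMap hk hF hc
  refine (Nat.card_congr ?_).symm
  refine (Equiv.mulLeft₀ z hz).subtypeEquiv fun x => ?_
  rw [tracePowForm_apply, tracePowForm_apply]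
  change _ ↔ Algebra.trace (ZMod p) F ((z * x) ^ (p ^ (e * k) + 1)) = c
  rw [mul_pow, hzc, ← Algebra.smul_def, map_smul, smul_eq_mul]
  constructor
  · intro h
    rw [h, mul_one]
  · intro h
    exact mul_left_cancel₀ hc (by rw [h, mul_one])

/-- The exponential sum of `Tr (x ^ (p ^ (e k) + 1))` on the field of order `p ^ (2 e s)` for odd
`k` and `s`. -/
theorem sum_addChar_tracePowForm_of_odd {ψ : AddChar (ZMod p) ℂ} (hψ : ψ.IsPrimitive)
    (hp : p ≠ 2) {e k s : ℕ} (he : e ≠ 0) (hk : Odd k) (hs : Odd s)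
    (hF : Fintype.card F = p ^ (2 * e * s)) {t : ZMod p} (ht : t ≠ 0) :
    ∑ x : F, ψ (t * tracePowForm p F (e * k) x) = -(p : ℂ) ^ (e * s) := by
  have hp2 := (Fact.out : p.Prime).two_le
  set Q := tracePowForm p F (e * k) with hQ
  -- Equal frequency of the nonzero values makes the sum this integer for every `t ≠ 0`. Hence the
  -- sums at `t` and `-t` coincide, and their product is `S²`.
  set S : ℤ := valueCount Q 0 - valueCount Q 1 with hS
  have hsum : ∀ t : ZMod p, t ≠ 0 → ∑ x : F, ψ (t * Q x) = S := by
    intro t ht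
    rw [sum_comp_eq_sum_valueCount Q fun a => ψ (t * a), sum_eq_zero_term_add]
    have : ∀ c ∈ Finset.univ.filter (fun c : ZMod p => c ≠ 0),
        valueCount Q c * ψ (t * c) = valueCount Q 1 * ψ (c * t) := by
      intro c hc
      rw [hQ, valueCount_eq_valueCount_one hk hF (by simpa using hc), mul_comm t]
    rw [Finset.sum_congr rfl this, ← Finset.mul_sum, sum_ne_zero_addChar_mul hψ, if_neg ht, hS]
    push_cast
    simp
    ring
  rw [hsum t ht]
  have hsq : S * S = (p ^ (e * s)) * (p ^ (e * s)) := by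
    have h := sum_addChar_mul_sum_addChar_neg hψ (Q := Q)
      (polar_tracePowForm_nondegenerate hp hF hs ⟨k, by ring⟩) ht
    rw [hsum t ht, hsum (-t) (neg_ne_zero.2 ht), hF] at h
    have h' : S * S = ((p ^ (2 * e * s) : ℕ) : ℤ) := by exact_mod_cast h
    rw [h']
    push_cast
    ring
  have hN : p ^ e + 1 ∣ Fintype.card F - 1 := by
    have h1 : p ^ (2 * e) - 1 = (p ^ e + 1) * (p ^ e - 1) := by
      rw [mul_comm 2 e, pow_mul, ← Nat.sq_sub_sq, one_pow]
    refine (Dvd.intro _ h1.symm).trans ?_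
    rw [hF, pow_mul p (2 * e) s]
    simpa using Nat.sub_dvd_pow_sub_pow (p ^ (2 * e)) 1 s
  have hn : p ^ e + 1 ∣ p ^ (e * k) + 1 := by
    simpa [pow_mul] using hk.nat_add_dvd_pow_add_pow (p ^ e) 1
  have hdvd : ∀ c : ZMod p, p ^ e + 1 ∣ Nat.card {x : Fˣ // Q x = c} := by
    intro c
    have := dvd_natCard_pow_eq hN hn fun x => Algebra.trace (ZMod p) F x = c
    simpa only [hQ, tracePowForm_apply] using this
  -- The units contribute multiples of `p^e + 1` to both counts; the `1` comes from `x = 0`.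
  have hS1 : ((p ^ e + 1 : ℕ) : ℤ) ∣ S - 1 := by
    rw [hS, valueCount_eq_natCard_units, valueCount_eq_natCard_units]
    obtain ⟨a, ha⟩ := hdvd 0
    obtain ⟨b, hb⟩ := hdvd 1
    refine ⟨a - b, ?_⟩
    rw [ha, hb]
    simp
    ring
  have hr : ((p ^ e + 1 : ℕ) : ℤ) ∣ (p ^ (e * s) : ℤ) + 1 := by
    have : p ^ e + 1 ∣ p ^ (e * s) + 1 := by
      simpa [pow_mul] using hs.nat_add_dvd_pow_add_pow (p ^ e) 1
    exact_mod_cast this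
  rcases mul_self_eq_mul_self_iff.1 hsq with h | h
  -- Since `p^(es) ≡ -1` modulo `p^e + 1`, the positive root would force `p^e + 1 ∣ 2`.
  · exfalso
    rw [h] at hS1
    have h2 : ((p ^ e + 1 : ℕ) : ℤ) ∣ 2 := by
      have := dvd_sub hr hS1
      ring_nf at this
      simpa [add_comm] using this
    have h3 : p ^ e + 1 ≤ 2 := Nat.le_of_dvd (by norm_num) (by exact_mod_cast h2)
    have h4 : p ≤ p ^ e := Nat.le_self_pow he p
    omega
  · rw [h]
    push_cast
    rfl

end FrobeniusForms

/-! ### Reduction to `Tr (x²)` and its exponential sum -/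

section SquareForms

variable {p : ℕ} [Fact p.Prime] {F : Type*} [Field F] [Fintype F] [Algebra (ZMod p) F]

/-- Modulo a common prime factor `r` one has `p^k = -1` and `p^m = 1`, so `p^(kj)` is both `-1` and
`1` and `r = 2`. But `k` is even, hence `p^k ≡ 1` mod 4 and `(p^k + 1)/2` is odd. -/
theorem coprime_card_sub_one_half_pow_add_one (hp : p ≠ 2) {m k j : ℕ} (hm : Even m)
    (hj : Odd j) (h : m ∣ k * j) : (p ^ m - 1).Coprime ((p ^ k + 1) / 2) := by
  have hpo : Odd p := (Fact.out : p.Prime).odd_of_ne_two hp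
  have hk : Even k := by
    have : Even (k * j) := even_iff_two_dvd.2 ((even_iff_two_dvd.1 hm).trans h)
    rcases Nat.even_mul.1 this with h | h
    · exact h
    · exact absurd h (Nat.not_even_iff_odd.2 hj)
  have hpk : p ^ k % 4 = 1 := by
    obtain ⟨i, rfl⟩ := hk
    rw [← two_mul, pow_mul, Nat.pow_mod]
    have : p ^ 2 % 4 = 1 := by
      rw [Nat.pow_mod]
      have : p % 4 = 1 ∨ p % 4 = 3 := by
        obtain ⟨a, rfl⟩ := hpo
        omega
      rcases this with h | h <;> simp [h]
    rw [this]
    simp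
  refine Nat.Coprime.symm (Nat.coprime_of_dvd fun r hr h1 h2 => ?_)
  have hr2 : r ≠ 2 := by
    rintro rfl
    omega
  have h3 : (p : ZMod r) ^ k = -1 := by
    have : r ∣ p ^ k + 1 := h1.trans (Nat.div_dvd_of_dvd (by omega))
    have := (ZMod.natCast_eq_zero_iff _ _).2 this
    push_cast at this
    exact eq_neg_of_add_eq_zero_left this
  have h4 : (p : ZMod r) ^ m = 1 := by
    have := (ZMod.natCast_eq_zero_iff _ _).2 h2
    rw [Nat.cast_sub (Nat.one_le_pow _ _ (Fact.out : p.Prime).pos)] at this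
    push_cast at this
    exact sub_eq_zero.1 this
  have h5 : (p : ZMod r) ^ (k * j) = -1 := by
    rw [pow_mul, h3, hj.neg_one_pow]
  have := Fact.mk hr
  obtain ⟨i, hi⟩ := h
  rw [hi, pow_mul, h4, one_pow] at h5
  have : Fact (2 < r) := ⟨by have := hr.two_le; omega⟩
  exact ZMod.neg_one_ne_one h5.symm

/-- If the automorphism `x ↦ x ^ p ^ k` has odd order, then `x ^ (p ^ k + 1)` and `x ^ 2` are
equidistributed. -/
theorem sum_comp_pow_eq_sum_comp_sq {K M : Type*} [Field K] [Fintype K] [AddCommMonoid M]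
    (hp : p ≠ 2) {m k j : ℕ} (hK : Fintype.card K = p ^ m) (hm : Even m) (hj : Odd j)
    (h : m ∣ k * j) (f : K → M) :
    ∑ x, f (x ^ (p ^ k + 1)) = ∑ x, f (x ^ 2) := by
  classical
  have hpo : Odd p := (Fact.out : p.Prime).odd_of_ne_two hp
  -- `x^(p^k+1)` is the square of `x^n`, and `x ↦ x^n` permutes the field because `n` is prime to
  -- the order of the unit group.
  set n := (p ^ k + 1) / 2 with hn
  have hn2 : p ^ k + 1 = n * 2 := by
    have := (hpo.pow (n := k)).add_one
    exact (Nat.div_mul_cancel (even_iff_two_dvd.1 this)).symm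
  have hn0 : n ≠ 0 := by
    rintro h0
    rw [h0] at hn2
    omega
  have hc : (Nat.card Kˣ).Coprime n := by
    rw [Nat.card_eq_fintype_card, Fintype.card_units, hK]
    exact coprime_card_sub_one_half_pow_add_one hp hm hj h
  have hb : Function.Bijective fun x : K => x ^ n := by
    rw [← Finite.injective_iff_bijective]
    intro x y hxy
    replace hxy : x ^ n = y ^ n := hxy
    by_cases hx : x = 0
    · rw [hx, zero_pow hn0] at hxy
      rw [hx, eq_zero_of_pow_eq_zero hxy.symm]
    · have hy : y ≠ 0 := by
        rintro rfl
        rw [zero_pow hn0] at hxy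
        exact hx (eq_zero_of_pow_eq_zero hxy)
      have := (Nat.Coprime.pow_left_bijective hc).1
        (a₁ := Units.mk0 x hx) (a₂ := Units.mk0 y hy) (by ext; simpa using hxy)
      simpa using congrArg Units.val this
  rw [← Equiv.sum_comp (Equiv.ofBijective _ hb) fun x => f (x ^ 2)]
  simp only [hn2, pow_mul, Equiv.ofBijective_apply]

theorem exists_sq_eq_neg_one {r : ℕ} (hF : Fintype.card F = r ^ 2) (hr : Odd r) :
    ∃ i : F, i ^ 2 = -1 := by
  have : IsSquare (-1 : F) := by
    rw [FiniteField.isSquare_neg_one_iff, hF, Nat.pow_mod]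
    have : r % 4 = 1 ∨ r % 4 = 3 := by
      obtain ⟨a, rfl⟩ := hr
      omega
    rcases this with h | h <;> simp [h]
  obtain ⟨i, hi⟩ := this
  exact ⟨i, by rw [hi, sq]⟩

variable {n : ℕ}

theorem frobPow_frobPow (hF : Fintype.card F = p ^ (2 * n)) (x : F) :
    frobPow p F n (frobPow p F n x) = x := by
  rw [frobPow_apply, frobPow_apply, ← pow_mul, ← pow_add, ← two_mul,
    pow_pow_eq_self_of_dvd hF dvd_rfl]

theorem trace_frobPow (n : ℕ) (x : F) :
    Algebra.trace (ZMod p) F (frobPow p F n x) = Algebra.trace (ZMod p) F x := by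
  rw [frobPow_apply, trace_pow]

/-- Let `τ x = x^(p^n)` and `i² = -1`; the congruence gives `τ i = i`. The linear substitution `x ↦
((1+i) x + (1-i) τ x)/2` turns `x²` into `x τ x + (z - τ z)` with `z = i x²/2`, and the trace kills
`z - τ z`. -/
theorem sum_comp_trace_sq_of_mod_four_eq_one {M : Type*} [AddCommMonoid M] (hp : p ≠ 2)
    (hF : Fintype.card F = p ^ (2 * n)) (hn : p ^ n % 4 = 1) (f : ZMod p → M) :
    ∑ x : F, f (Algebra.trace (ZMod p) F (x ^ 2))
      = ∑ x : F, f (Algebra.trace (ZMod p) F (x ^ (p ^ n + 1))) := by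
  have h2 : (2 : F) ≠ 0 := two_ne_zero_of_odd (p := p) hp
  obtain ⟨i, hi⟩ := exists_sq_eq_neg_one (F := F) (r := p ^ n) (by rw [hF, ← pow_mul, mul_comm])
    (Nat.odd_iff.2 (by omega))
  have hτi : frobPow p F n i = i := by
    rw [frobPow_apply, ← Nat.div_add_mod (p ^ n) 4, hn, pow_add, pow_mul,
      show i ^ 4 = (i ^ 2) ^ 2 by ring, hi]
    simp
  let φ : F → F := fun x => ((1 + i) * x + (1 - i) * frobPow p F n x) / 2
  have hτφ : ∀ x, frobPow p F n (φ x) = ((1 + i) * frobPow p F n x + (1 - i) * x) / 2 := by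
    intro x
    have h3 : frobPow p F n (2 : F) = 2 := map_ofNat _ 2
    simp [φ, hτi, h3, frobPow_frobPow hF]
  have hφ : Function.Bijective φ := by
    rw [← Finite.injective_iff_bijective]
    refine Function.LeftInverse.injective
      (g := fun y => ((1 - i) * y + (1 + i) * frobPow p F n y) / 2) fun x => ?_
    change ((1 - i) * φ x + (1 + i) * frobPow p F n (φ x)) / 2 = x
    rw [hτφ]
    simp only [φ]
    field_simp
    linear_combination (2 * frobPow p F n x - 2 * x) * hi
  rw [← Equiv.sum_comp (Equiv.ofBijective φ hφ)]
  refine Finset.sum_congr rfl fun x _ => congrArg f ?_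
  have h1 : (Equiv.ofBijective φ hφ x) ^ 2
      = x ^ (p ^ n + 1) + (i * x ^ 2 / 2 - frobPow p F n (i * x ^ 2 / 2)) := by
    rw [map_div₀, map_mul, hτi, map_pow, pow_succ x, ← frobPow_apply]
    simp only [φ, Equiv.ofBijective_apply]
    have h3 : frobPow p F n (2 : F) = 2 := map_ofNat _ 2
    rw [h3]
    field_simp
    linear_combination (x - frobPow p F n x) ^ 2 * hi
  rw [h1, map_add, map_sub, trace_frobPow, sub_self, add_zero]

/-- Now `τ i = -i`, so `F = E ⊕ iE` for the fixed field `E` of `τ`, and `iE` has trace zero. In the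
coordinates `(a + b)/2 + i (a - b)/2` the form is the hyperbolic `Tr (a b)`; summing over `b` leaves
only `a = 0`, which contributes the order of `E`. -/
theorem sum_addChar_trace_sq_of_mod_four_eq_three {ψ : AddChar (ZMod p) ℂ} (hψ : ψ.IsPrimitive)
    (hp : p ≠ 2) (hF : Fintype.card F = p ^ (2 * n)) (hn : p ^ n % 4 = 3) {t : ZMod p}
    (ht : t ≠ 0) :
    ∑ x : F, ψ (t * Algebra.trace (ZMod p) F (x ^ 2)) = (p : ℂ) ^ n := by
  classical
  have h2 : (2 : F) ≠ 0 := two_ne_zero_of_odd (p := p) hp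
  have h2' : (2 : ZMod p) ≠ 0 := two_ne_zero_of_odd (p := p) hp
  set τ := frobPow p F n with hτ
  have hτ2 : τ 2 = 2 := map_ofNat _ 2
  obtain ⟨i, hi⟩ := exists_sq_eq_neg_one (F := F) (r := p ^ n) (by rw [hF, ← pow_mul, mul_comm])
    (Nat.odd_iff.2 (by omega))
  have hτi : τ i = -i := by
    rw [hτ, frobPow_apply, ← Nat.div_add_mod (p ^ n) 4, hn, pow_add, pow_mul,
      show i ^ 4 = (i ^ 2) ^ 2 by ring, show i ^ 3 = i ^ 2 * i by ring, hi]
    simp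
  have hττ : ∀ x, τ (τ x) = x := frobPow_frobPow hF
  let E : Submodule (ZMod p) F := LinearMap.ker (τ.toLinearMap - LinearMap.id)
  have hE : ∀ x, x ∈ E ↔ τ x = x := by
    intro x
    simp [E, sub_eq_zero]
  let e : E × E ≃ F :=
    { toFun := fun a => (a.1 + a.2) / 2 + i * ((a.1 - a.2) / 2)
      invFun := fun x =>
        (⟨(x + τ x) / 2 - i * ((x - τ x) / 2), (hE _).2 (by simp [hτi, hττ, hτ2]; ring)⟩,
          ⟨(x + τ x) / 2 + i * ((x - τ x) / 2), (hE _).2 (by simp [hτi, hττ, hτ2]; ring)⟩)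
      left_inv := by
        rintro ⟨⟨a, ha⟩, ⟨b, hb⟩⟩
        have ha := (hE _).1 ha
        have hb := (hE _).1 hb
        ext
        · simp only [map_add, map_mul, map_div₀, map_sub, ha, hb, hτi, hτ2]
          field_simp
          linear_combination (-2 * (a - b)) * hi
        · simp only [map_add, map_mul, map_div₀, map_sub, ha, hb, hτi, hτ2]
          field_simp
          linear_combination (2 * (a - b)) * hi
      right_inv := by
        intro x
        simp only
        field_simp
        linear_combination (-2 * (x - τ x)) * hi }
  have hcard : (Fintype.card E : ℂ) = (p : ℂ) ^ n := by
    have h := Fintype.card_congr e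
    rw [Fintype.card_prod, hF, two_mul, pow_add] at h
    have : Fintype.card E = p ^ n := Nat.mul_self_inj.1 h
    rw [this]
    push_cast
    rfl
  have htr : ∀ a : E × E, Algebra.trace (ZMod p) F ((e a) ^ 2)
      = Algebra.trace (ZMod p) F (a.1 * a.2 : F) := by
    rintro ⟨⟨a, ha⟩, ⟨b, hb⟩⟩
    have ha' := (hE _).1 ha
    have hb' := (hE _).1 hb
    have h1 : (e (⟨a, ha⟩, ⟨b, hb⟩)) ^ 2 = a * b + i * ((a ^ 2 - b ^ 2) / 2) := by
      change ((a + b) / 2 + i * ((a - b) / 2)) ^ 2 = _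
      field_simp
      linear_combination ((a - b) ^ 2) * hi
    have h3 : Algebra.trace (ZMod p) F (i * ((a ^ 2 - b ^ 2) / 2)) = 0 := by
      have h4 := trace_frobPow (p := p) n (i * ((a ^ 2 - b ^ 2) / 2))
      rw [← hτ, map_mul, hτi, map_div₀, map_sub, map_pow, map_pow, ha', hb', hτ2, neg_mul, map_neg]
        at h4
      have h5 : 2 * Algebra.trace (ZMod p) F (i * ((a ^ 2 - b ^ 2) / 2)) = 0 := by
        linear_combination -h4
      exact (mul_eq_zero.1 h5).resolve_left h2'
    change Algebra.trace (ZMod p) F (e (⟨a, ha⟩, ⟨b, hb⟩) ^ 2) = _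
    rw [h1, map_add, h3, add_zero]
  rw [← Equiv.sum_comp e, Fintype.sum_prod_type, Finset.sum_eq_single 0]
  · simp only [htr]
    simp [hcard]
  · intro a _ ha
    simp only [htr]
    let f : E →ₗ[ZMod p] ZMod p :=
      t • ((Algebra.traceForm (ZMod p) F (a : F)).comp E.subtype)
    refine sum_addChar_linear_eq_zero hψ f fun hf => ha ?_
    apply Subtype.ext
    refine eq_zero_of_trace_mul (p := p) fun x => ?_
    -- Orthogonality of `a` is known only against `E`; since `τ a = a`, testing on `x + τ x` gives
    -- `2 Tr (a x) = 0` for all `x` in `F`.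
    have hmem : x + τ x ∈ E := (hE _).2 (by rw [map_add, hττ, add_comm])
    have h1 : t * Algebra.trace (ZMod p) F (a * (x + τ x)) = 0 :=
      LinearMap.congr_fun hf ⟨_, hmem⟩
    have h3 := (mul_eq_zero.1 h1).resolve_left ht
    have h4 : Algebra.trace (ZMod p) F (a * τ x) = Algebra.trace (ZMod p) F (a * x) := by
      rw [← trace_frobPow n (a * x : F), ← hτ, map_mul τ, (hE _).1 a.2]
    rw [mul_add, map_add, h4] at h3
    have h5 : 2 * Algebra.trace (ZMod p) F (a * x) = 0 := by
      linear_combination h3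
    exact (mul_eq_zero.1 h5).resolve_left h2'
  · simp

theorem exists_eq_two_pow_mul_odd {n : ℕ} (hn : n ≠ 0) :
    ∃ s, Odd s ∧ n = 2 ^ padicValNat 2 n * s := by
  obtain ⟨s, hs⟩ := pow_padicValNat_dvd (p := 2) (n := n)
  refine ⟨s, ?_, hs⟩
  rw [← Nat.not_even_iff_odd]
  rintro ⟨r, hr⟩
  rw [hr] at hs
  have : 2 ^ (padicValNat 2 n + 1) ∣ n := ⟨r, by rw [pow_succ, mul_assoc, two_mul]; exact hs⟩
  exact pow_succ_padicValNat_not_dvd hn this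

/-- The exponential sum of the trace of `x ^ 2` on a field of order `p ^ (2 n)`. -/
theorem sum_addChar_trace_sq {ψ : AddChar (ZMod p) ℂ} (hψ : ψ.IsPrimitive)
    (hp : p ≠ 2) (hn0 : n ≠ 0) (hF : Fintype.card F = p ^ (2 * n)) {t : ZMod p} (ht : t ≠ 0) :
    ∑ x : F, ψ (t * Algebra.trace (ZMod p) F (x ^ 2))
      = -((-1 : ℤ) ^ ((p - 1) * (2 * n) / 4) : ℤ) * (p : ℂ) ^ n := by
  have hpo : Odd p := (Fact.out : p.Prime).odd_of_ne_two hp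
  obtain ⟨a, ha⟩ := hpo
  have hexp : (p - 1) * (2 * n) / 4 = a * n := by
    rw [ha, Nat.add_sub_cancel, show 2 * a * (2 * n) = 4 * (a * n) by ring]
    simp
  rw [hexp, pow_mul]
  -- As `p = 2a + 1 ≡ (-1)^a` mod 4, the sign in the statement records which of the two cases for
  -- `p^n` mod 4 holds.
  have hmod : ((p ^ n : ℕ) : ZMod 4) = ((-1) ^ a) ^ n := by
    push_cast
    congr 1
    rw [ha]
    push_cast
    rcases Nat.even_or_odd a with h | h
    · rw [h.neg_one_pow]
      obtain ⟨b, rfl⟩ := h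
      push_cast
      rw [show (2 : ZMod 4) * (b + b) + 1 = 4 * b + 1 by ring, show (4 : ZMod 4) = 0 from rfl]
      simp
    · rw [h.neg_one_pow]
      obtain ⟨b, rfl⟩ := h
      push_cast
      rw [show (2 : ZMod 4) * (2 * b + 1) + 1 = 4 * b + 3 by ring, show (4 : ZMod 4) = 0 from rfl]
      simp
      rfl
  rw [← pow_mul] at hmod ⊢
  rcases Nat.even_or_odd (a * n) with h | h
  · rw [h.neg_one_pow] at hmod ⊢
    have h1 : p ^ n % 4 = 1 := (ZMod.natCast_eq_natCast_iff' (p ^ n) 1 4).1 (by simpa using hmod)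
    rw [sum_comp_trace_sq_of_mod_four_eq_one hp hF h1 fun a => ψ (t * a)]
    obtain ⟨s, hs, hns⟩ := exists_eq_two_pow_mul_odd hn0
    set e := 2 ^ padicValNat 2 n
    -- With `e` the 2-part and `s` the odd part of `n`, the exponent `e s` is `n` itself: `Tr
    -- (x^(p^n+1))` is a deficient form.
    have := sum_addChar_tracePowForm_of_odd (F := F) hψ hp (e := e) (k := s) (s := s)
      (by positivity) hs hs (by rw [hF, mul_assoc, ← hns]) ht
    simp only [tracePowForm_apply, ← hns] at this
    rw [this]
    simp
  · rw [h.neg_one_pow] at hmod ⊢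
    have h3 : p ^ n % 4 = 3 := (ZMod.natCast_eq_natCast_iff' (p ^ n) 3 4).1 (by rw [hmod]; rfl)
    rw [sum_addChar_trace_sq_of_mod_four_eq_three hψ hp hF h3 ht]
    simp

end SquareForms

/-! ### The form in two variables and the codewords as polar functionals -/

section ProductForm

theorem exists_odd_dvd_mul_of_padicValNat_gcd_eq {m k : ℕ} (hm : m ≠ 0)
    (h : padicValNat 2 (Nat.gcd k m) = padicValNat 2 m) : ∃ j, Odd j ∧ m ∣ k * j := by
  obtain ⟨s, hs, hms⟩ := exists_eq_two_pow_mul_odd hm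
  refine ⟨s, hs, ?_⟩
  have h1 : 2 ^ padicValNat 2 m ∣ k := by
    rw [← h]
    exact pow_padicValNat_dvd.trans (Nat.gcd_dvd_left _ _)
  conv_lhs => rw [hms]
  exact mul_dvd_mul_right h1 s

theorem exists_eq_mul_odd_of_padicValNat_gcd_add_one_eq {m k : ℕ} (hm : m ≠ 0)
    (h : padicValNat 2 (Nat.gcd k m) + 1 = padicValNat 2 m) :
    ∃ e i s, e ≠ 0 ∧ Odd i ∧ Odd s ∧ k = e * i ∧ m = 2 * e * s := by
  obtain ⟨s, hs, hms⟩ := exists_eq_two_pow_mul_odd hm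
  have h1 : 2 ^ padicValNat 2 (Nat.gcd k m) ∣ k :=
    pow_padicValNat_dvd.trans (Nat.gcd_dvd_left _ _)
  obtain ⟨i, hi⟩ := h1
  refine ⟨2 ^ padicValNat 2 (Nat.gcd k m), i, s, by positivity, ?_, hs, hi, ?_⟩
  · rw [← Nat.not_even_iff_odd]
    rintro ⟨r, hr⟩
    have h2 : 2 ^ (padicValNat 2 (Nat.gcd k m) + 1) ∣ k := by
      conv_rhs => rw [hi, hr]
      exact ⟨r, by ring⟩
    have h3 : 2 ^ (padicValNat 2 (Nat.gcd k m) + 1) ∣ m := by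
      rw [h]
      exact pow_padicValNat_dvd
    exact pow_succ_padicValNat_not_dvd (Nat.gcd_ne_zero_right hm) (Nat.dvd_gcd h2 h3)
  · rw [← pow_succ', h]
    exact hms

variable {p : ℕ} [Fact p.Prime] {F : Type*} [Field F] [Fintype F] [Algebra (ZMod p) F]

/-- The quadratic form `Tr (x ^ (p ^ k + 1) + y ^ (p ^ l + 1))`. -/
noncomputable def tracePowProdForm (p : ℕ) [Fact p.Prime] (F : Type*) [Field F] [Fintype F]
    [Algebra (ZMod p) F] (k l : ℕ) : QuadraticForm (ZMod p) (F × F) :=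
  (tracePowForm p F k).prod (tracePowForm p F l)

theorem tracePowProdForm_apply (k l : ℕ) (v : F × F) :
    tracePowProdForm p F k l v
      = Algebra.trace (ZMod p) F (v.1 ^ (p ^ k + 1) + v.2 ^ (p ^ l + 1)) := by
  rw [tracePowProdForm, QuadraticMap.prod_apply, tracePowForm_apply, tracePowForm_apply, map_add]

theorem sum_addChar_tracePowProdForm (ψ : AddChar (ZMod p) ℂ) (k l : ℕ) (t : ZMod p) :
    ∑ v, ψ (t * tracePowProdForm p F k l v)
      = (∑ x, ψ (t * tracePowForm p F k x)) * ∑ y, ψ (t * tracePowForm p F l y) := by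
  rw [Finset.sum_mul_sum, Fintype.sum_prod_type]
  refine Finset.sum_congr rfl fun x _ => Finset.sum_congr rfl fun y _ => ?_
  rw [← AddChar.map_add_eq_mul, tracePowProdForm, QuadraticMap.prod_apply, mul_add]

/-- The factor of full valuation has the sum of `Tr (x²)`, which is `-ε p^(m/2)`, and the deficient
factor is `-p^(m/2)`; the minus signs cancel. -/
theorem sum_addChar_tracePowForm_mul {ψ : AddChar (ZMod p) ℂ} (hψ : ψ.IsPrimitive)
    (hp : p ≠ 2) {m k l : ℕ} (hm : m ≠ 0) (hF : Fintype.card F = p ^ m)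
    (hk : padicValNat 2 (Nat.gcd k m) = padicValNat 2 m)
    (hl : padicValNat 2 (Nat.gcd l m) + 1 = padicValNat 2 m) {t : ZMod p} (ht : t ≠ 0) :
    (∑ x : F, ψ (t * tracePowForm p F k x)) * ∑ y : F, ψ (t * tracePowForm p F l y)
      = ((-1 : ℤ) ^ ((p - 1) * m / 4) : ℤ) * (p : ℂ) ^ m := by
  obtain ⟨j, hj, hkj⟩ := exists_odd_dvd_mul_of_padicValNat_gcd_eq hm hk
  obtain ⟨e, i, s, he, hi, hs, rfl, rfl⟩ := exists_eq_mul_odd_of_padicValNat_gcd_add_one_eq hm hl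
  rw [sum_addChar_tracePowForm_of_odd hψ hp he hi hs hF ht]
  simp only [tracePowForm_apply]
  have hes : e * s ≠ 0 := by
    rw [mul_assoc] at hm
    exact right_ne_zero_of_mul hm
  rw [sum_comp_pow_eq_sum_comp_sq hp hF ⟨e * s, by ring⟩ hj hkj
      fun x => ψ (t * Algebra.trace (ZMod p) F x),
    sum_addChar_trace_sq hψ hp hes (by rw [hF, mul_assoc]) ht, mul_assoc 2 e s]
  ring

theorem polar_tracePowForm_nondegenerate_of_padicValNat (hp : p ≠ 2) {m k : ℕ} (hm : m ≠ 0)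
    (hF : Fintype.card F = p ^ m)
    (hk : padicValNat 2 (Nat.gcd k m) = padicValNat 2 m ∨
      padicValNat 2 (Nat.gcd k m) + 1 = padicValNat 2 m) (w : F)
    (h : ∀ v, QuadraticMap.polar (tracePowForm p F k) v w = 0) : w = 0 := by
  rcases hk with hk | hk
  · obtain ⟨j, hj, hkj⟩ := exists_odd_dvd_mul_of_padicValNat_gcd_eq hm hk
    exact polar_tracePowForm_nondegenerate hp hF hj (by rw [mul_assoc]; exact hkj.mul_left 2) w h
  · obtain ⟨e, i, s, he, hi, hs, rfl, rfl⟩ := exists_eq_mul_odd_of_padicValNat_gcd_add_one_eq hm hk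
    exact polar_tracePowForm_nondegenerate hp hF hs ⟨i, by ring⟩ w h

/-- The functional `polar (tracePowForm k) · w` is `v ↦ Tr (a v)` for `a` ranging over `F` as `w`
does. -/
theorem exists_bijective_polar_tracePowForm {k : ℕ}
    (hk : ∀ w, (∀ v, QuadraticMap.polar (tracePowForm p F k) v w = 0) → w = 0) :
    ∃ L : F → F, Function.Surjective L ∧ ∀ v w,
      QuadraticMap.polar (tracePowForm p F k) v w = Algebra.trace (ZMod p) F (L w * v) := by
  -- The adjoint of a field automorphism for the trace form is its inverse.
  let L : F →ₗ[ZMod p] F := (frobPow p F k).symm.toLinearMap + (frobPow p F k).toLinearMap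
  have hL : ∀ v w,
      QuadraticMap.polar (tracePowForm p F k) v w = Algebra.trace (ZMod p) F (L w * v) := by
    intro v w
    obtain ⟨u, rfl⟩ := (frobPow p F k).surjective w
    have : L (frobPow p F k u) = u + frobPow p F k (frobPow p F k u) := by simp [L]
    rw [this, polar_tracePowForm, frobPow_apply, ← mul_pow, trace_pow, ← map_add, frobPow_apply]
    congr 1
    ring
  refine ⟨L, Finite.injective_iff_surjective.1 ?_, hL⟩
  rw [← LinearMap.ker_eq_bot, LinearMap.ker_eq_bot']
  intro w hw
  exact hk w fun v => by rw [hL, hw, zero_mul, map_zero]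

theorem polar_tracePowProdForm (k l : ℕ) (v w : F × F) :
    QuadraticMap.polar (tracePowProdForm p F k l) v w
      = QuadraticMap.polar (tracePowForm p F k) v.1 w.1
        + QuadraticMap.polar (tracePowForm p F l) v.2 w.2 := by
  rw [tracePowProdForm, QuadraticMap.polar_prod]

/-- Nondegeneracy lets every pair `(a, b)` be written as the image of some `w`. Indexing codewords
by `w` is what makes `Q w` available as their invariant. -/
theorem mem_codeOf_iff {k l : ℕ}
    (hk : ∀ w, (∀ v, QuadraticMap.polar (tracePowForm p F k) v w = 0) → w = 0)
    (hl : ∀ w, (∀ v, QuadraticMap.polar (tracePowForm p F l) v w = 0) → w = 0)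
    (D : Finset (F × F)) (f : D → ZMod p) :
    f ∈ codeOf p D ↔ ∃ w, f = fun d : D =>
      QuadraticMap.polar (tracePowProdForm p F k l) (d : F × F) w := by
  obtain ⟨L, hL, hLp⟩ := exists_bijective_polar_tracePowForm hk
  obtain ⟨M, hM, hMp⟩ := exists_bijective_polar_tracePowForm hl
  simp only [polar_tracePowProdForm, hLp, hMp, ← map_add]
  constructor
  · rintro ⟨a, b, rfl⟩
    obtain ⟨x, rfl⟩ := hL a
    obtain ⟨y, rfl⟩ := hM b
    exact ⟨(x, y), rfl⟩
  · rintro ⟨w, rfl⟩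
    exact ⟨L w.1, M w.2, rfl⟩

theorem exists_polar_tracePowProdForm_ne_zero {k l : ℕ}
    (hk : ∀ w, (∀ v, QuadraticMap.polar (tracePowForm p F k) v w = 0) → w = 0)
    (hl : ∀ w, (∀ v, QuadraticMap.polar (tracePowForm p F l) v w = 0) → w = 0)
    {w : F × F} (hw : w ≠ 0) :
    ∃ v, QuadraticMap.polar (tracePowProdForm p F k l) v w ≠ 0 := by
  by_contra! h
  simp only [polar_tracePowProdForm] at h
  refine hw (Prod.ext (hk _ fun v => ?_) (hl _ fun v => ?_))
  · simpa using h (v, 0)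
  · simpa using h (0, v)

end ProductForm

/-! ### Weights and dimension of a code of polar functionals -/

section PolarCode

variable {p : ℕ} [Fact p.Prime] {V : Type*} [AddCommGroup V] [Module (ZMod p) V] [Fintype V]

/-- The code of the functionals `polar Q · w` restricted to the nonzero vectors with `Q v = c`, for
a nondegenerate form `Q` of dimension `2 m` and sign `ε`, given by its counting functions. -/
structure IsPolarCode (Q : QuadraticForm (ZMod p) V) (c : ZMod p) (D : Finset V)
    (C : Submodule (ZMod p) (D → ZMod p)) (ε : ℤ) (m : ℕ) : Prop where
  odd : p ≠ 2
  sign : ε = 1 ∨ ε = -1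
  two_le : 2 ≤ m
  card : Fintype.card V = p ^ (2 * m)
  mem_support : ∀ v, v ∈ D ↔ v ≠ 0 ∧ Q v = c
  mem_code : ∀ f, f ∈ C ↔ ∃ w, f = fun d : D => QuadraticMap.polar Q (d : V) w
  valueCount_eq : ∀ a, (valueCount Q a : ℤ)
    = (p : ℤ) ^ (2 * m - 1) + ε * (p : ℤ) ^ (m - 1) * ((if a = 0 then (p : ℤ) else 0) - 1)
  sliceCount_eq : ∀ w, w ≠ 0 → ∀ a ρ, (sliceCount Q w a ρ : ℤ)
    = (p : ℤ) ^ (2 * m - 2) + ε * (p : ℤ) ^ (m - 1) * (rootCount (Q w) ρ a - 1)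

theorem rootCount_zero_left_of_ne {ρ c : ZMod p} (hρ : ρ ≠ 0) : rootCount 0 ρ c = 1 := by
  rw [rootCount, Nat.card_eq_one_iff_unique]
  refine ⟨⟨fun a b => Subtype.ext ?_⟩, ⟨⟨-c / ρ, by field_simp; ring⟩⟩⟩
  have ha := a.2
  have hb := b.2
  exact mul_right_cancel₀ hρ (by linear_combination ha - hb)

theorem rootCount_zero_zero (c : ZMod p) : rootCount 0 0 c = if c = 0 then p else 0 := by
  split_ifs with hc
  · simp [rootCount, hc]
  · simp [rootCount, hc]

/-- Completing the square, `s ↦ 2 A s + ρ` carries the roots to the square roots of the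
discriminant. -/
theorem rootCount_of_ne_zero (hp : p ≠ 2) {A : ZMod p} (hA : A ≠ 0) (ρ c : ZMod p) :
    (rootCount A ρ c : ℤ) = 1 + quadraticChar (ZMod p) (ρ ^ 2 - 4 * (A * c)) := by
  have h2 : (2 : ZMod p) ≠ 0 := two_ne_zero_of_odd (p := p) hp
  have h := quadraticChar_card_sqrts (F := ZMod p) (by rwa [ringChar.eq (ZMod p) p])
    (ρ ^ 2 - 4 * (A * c))
  rw [add_comm, ← h, Set.toFinset_card, rootCount, Nat.card_eq_fintype_card]
  congr 1
  refine Fintype.card_congr ?_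
  have hA2 : 2 * A ≠ 0 := mul_ne_zero h2 hA
  refine ((Equiv.mulLeft₀ (2 * A) hA2).trans (Equiv.addRight ρ)).subtypeEquiv fun s => ?_
  change _ ↔ (2 * A * s + ρ) ^ 2 = ρ ^ 2 - 4 * (A * c)
  constructor
  · intro h
    linear_combination (4 * A) * h
  · intro h
    refine mul_left_cancel₀ (mul_ne_zero h2 hA2) ?_
    linear_combination h

variable {Q : QuadraticForm (ZMod p) V} {c : ZMod p} {D : Finset V}
  {C : Submodule (ZMod p) (D → ZMod p)} {ε : ℤ} {m : ℕ}

theorem hammingNorm_add_symbolCount_zero {K ι : Type*} [Field K] [Fintype K] [DecidableEq K]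
    [Fintype ι] (f : ι → K) : hammingNorm f + symbolCount f 0 = Fintype.card ι := by
  rw [hammingNorm, symbolCount, add_comm, Finset.card_filter_add_card_filter_not,
    Finset.card_univ]

namespace IsPolarCode

variable (h : IsPolarCode Q c D C ε m)
include h

/-- The correction is the zero vector, which `D` omits and which lies in the slice only for `c = ρ =
0`. -/
theorem symbolCount_add (w : V) (ρ : ZMod p) :
    symbolCount (fun d : D => QuadraticMap.polar Q (d : V) w) ρ
      + (if c = 0 ∧ ρ = 0 then 1 else 0) = sliceCount Q w c ρ := by
  classical
  have h1 : symbolCount (fun d : D => QuadraticMap.polar Q (d : V) w) ρ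
      = (Finset.univ.filter fun v : V => v ≠ 0 ∧ Q v = c ∧ QuadraticMap.polar Q v w = ρ).card := by
    rw [symbolCount]
    refine Finset.card_bij (fun d _ => (d : V)) ?_ ?_ ?_
    · intro d hd
      have := (h.mem_support d).1 d.2
      simp only [Finset.mem_filter, Finset.mem_univ, true_and] at hd ⊢
      exact ⟨this.1, this.2, hd⟩
    · intro x _ y _ hxy
      exact Subtype.ext hxy
    · intro v hv
      simp only [Finset.mem_filter, Finset.mem_univ, true_and] at hv
      exact ⟨⟨v, (h.mem_support v).2 ⟨hv.1, hv.2.1⟩⟩, by simpa using hv.2.2, rfl⟩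
  rw [h1, sliceCount, Nat.card_eq_fintype_card, Fintype.card_subtype]
  split_ifs with hc
  · obtain ⟨hc, rfl⟩ := hc
    have : (Finset.univ.filter fun v => Q v = c ∧ QuadraticMap.polar Q v w = 0)
        = insert 0 (Finset.univ.filter fun v : V =>
          v ≠ 0 ∧ Q v = c ∧ QuadraticMap.polar Q v w = 0) := by
      ext v
      by_cases hv : v = 0 <;> simp [hv, hc]
    rw [this, Finset.card_insert_of_notMem (by simp)]
  · rw [add_zero]
    congr 1
    ext v
    simp only [Finset.mem_filter, Finset.mem_univ, true_and]
    refine ⟨fun h => h.2, fun h => ⟨?_, h⟩⟩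
    rintro rfl
    exact hc ⟨by rw [← h.1, map_zero], by rw [← h.2, QuadraticMap.polar_zero_left]⟩

theorem card_support : (D.card : ℤ) = valueCount Q c - if c = 0 then 1 else 0 := by
  classical
  rw [valueCount, Nat.card_eq_fintype_card, Fintype.card_subtype]
  have h1 : D = (Finset.univ.filter fun v : V => Q v = c).erase 0 := by
    ext v
    simp [h.mem_support]
  split_ifs with hc
  · have h0 : (0 : V) ∈ Finset.univ.filter fun v : V => Q v = c := by simp [hc]
    conv_lhs => rw [h1]
    rw [Finset.card_erase_of_mem h0, Nat.cast_sub (Finset.card_pos.2 ⟨_, h0⟩)]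
    simp
  · rw [sub_zero]
    conv_lhs => rw [h1]
    rw [Finset.erase_eq_of_notMem]
    simp [Ne.symm hc]

theorem symbolCount_eq {w : V} (hw : w ≠ 0) (ρ : ZMod p) :
    (symbolCount (fun d : D => QuadraticMap.polar Q (d : V) w) ρ : ℤ)
      = (p : ℤ) ^ (2 * m - 2) + ε * (p : ℤ) ^ (m - 1) * (rootCount (Q w) ρ c - 1)
        - if c = 0 ∧ ρ = 0 then 1 else 0 := by
  rw [← h.sliceCount_eq w hw, ← h.symbolCount_add]
  push_cast
  ring

theorem pow_eq : (p : ℤ) ^ (2 * m - 1) = p * (p : ℤ) ^ (2 * m - 2) := by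
  rw [← pow_succ']
  congr 1
  have := h.two_le
  omega

theorem pow_eq_mul : (p : ℤ) ^ (2 * m - 2) = (p : ℤ) ^ (m - 1) * (p : ℤ) ^ (m - 1) := by
  rw [← pow_add]
  congr 1
  have := h.two_le
  omega

theorem three_le : 3 ≤ p := by
  have := (Fact.out : p.Prime).two_le
  have := h.odd
  omega

theorem three_le_pow : 3 ≤ (p : ℤ) ^ (m - 1) := by
  have h1 : p ^ 1 ≤ p ^ (m - 1) :=
    Nat.pow_le_pow_right (by have := h.three_le; omega) (by have := h.two_le; omega)
  rw [pow_one] at h1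
  have := h.three_le
  have h2 : 3 ≤ p ^ (m - 1) := by omega
  exact_mod_cast h2

/-- The weight is the length minus the number of zero components; the corrections for the omitted
zero vector cancel. -/
theorem hammingNorm_eq {w : V} (hw : w ≠ 0) :
    (hammingNorm (fun d : D => QuadraticMap.polar Q (d : V) w) : ℤ)
      = (p - 1) * (p : ℤ) ^ (2 * m - 2)
        + ε * (p : ℤ) ^ (m - 1) * ((if c = 0 then (p : ℤ) else 0) - rootCount (Q w) 0 c) := by
  have h1 := hammingNorm_add_symbolCount_zero (fun d : D => QuadraticMap.polar Q (d : V) w)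
  rw [Fintype.card_coe] at h1
  have h2 : (hammingNorm (fun d : D => QuadraticMap.polar Q (d : V) w) : ℤ)
      = D.card - symbolCount (fun d : D => QuadraticMap.polar Q (d : V) w) 0 := by
    rw [← h1]
    push_cast
    ring
  rw [h2, h.card_support, h.symbolCount_eq hw, h.valueCount_eq, h.pow_eq]
  simp only [and_true]
  ring

theorem hammingNorm_pos {w : V} (hw : w ≠ 0) :
    0 < hammingNorm (fun d : D => QuadraticMap.polar Q (d : V) w) := by
  have h1 := h.hammingNorm_eq hw
  have h3 := h.three_le_pow
  have hp3 : (3 : ℤ) ≤ p := by exact_mod_cast h.three_le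
  -- With `P = p^(m-1)` the weight is `P` times `(p-1) P` plus this quantity, hence positive since
  -- `P > 1`. The quantity in absolute value is `0`, `p - 1` or `2`.
  have hb : |ε * ((if c = 0 then (p : ℤ) else 0) - rootCount (Q w) 0 c)| ≤ p - 1 := by
    rw [abs_mul]
    have hε : |ε| = 1 := by rcases h.sign with h | h <;> simp [h]
    rw [hε, one_mul, abs_le]
    by_cases hA : Q w = 0
    · rw [hA, rootCount_zero_zero]
      split_ifs <;> constructor <;> push_cast <;> linarith
    · rw [rootCount_of_ne_zero h.odd hA]
      by_cases hc : c = 0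
      · simp only [hc, if_true]
        simp
        linarith
      · rw [if_neg hc]
        have h4 : (-4 : ZMod p) * (Q w * c) ≠ 0 := by
          have h2 : (2 : ZMod p) ≠ 0 := two_ne_zero_of_odd (p := p) h.odd
          have : (-4 : ZMod p) = -(2 * 2) := by norm_num
          rw [this]
          exact mul_ne_zero (neg_ne_zero.2 (mul_ne_zero h2 h2)) (mul_ne_zero hA hc)
        have : (0 : ZMod p) ^ 2 - 4 * (Q w * c) = -4 * (Q w * c) := by ring
        rw [this]
        rcases quadraticChar_dichotomy h4 with h5 | h5 <;> rw [h5] <;> constructor <;> linarith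
  have hb' := (abs_le.1 hb).1
  have h4 : 0 < (hammingNorm (fun d : D => QuadraticMap.polar Q (d : V) w) : ℤ) := by
    rw [h1, h.pow_eq_mul]
    nlinarith [mul_le_mul_of_nonneg_left hb' (by linarith : 0 ≤ (p : ℤ) ^ (m - 1)),
      mul_pos (by linarith : (0 : ℤ) < p - 1) (by nlinarith :
        0 < (p : ℤ) ^ (m - 1) * ((p : ℤ) ^ (m - 1) - 1))]
  exact_mod_cast h4

theorem encode_injective :
    Function.Injective fun (w : V) (d : D) => QuadraticMap.polar Q (d : V) w := by
  intro w w' hww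
  by_contra hne
  have h1 := h.hammingNorm_pos (sub_ne_zero.2 hne)
  have h2 : (fun d : D => QuadraticMap.polar Q (d : V) (w - w')) = 0 := by
    funext d
    rw [QuadraticMap.polar_sub_right]
    exact sub_eq_zero.2 (congrFun hww d)
  rw [h2, hammingNorm_zero] at h1
  exact lt_irrefl _ h1

theorem finrank_eq : Module.finrank (ZMod p) C = 2 * m := by
  classical
  have h1 : Nat.card C = Nat.card V := by
    refine (Nat.card_congr (Equiv.ofBijective
      (fun w : V => (⟨fun d : D => QuadraticMap.polar Q (d : V) w, (h.mem_code _).2 ⟨w, rfl⟩⟩ : C))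
      ⟨fun w w' hww => h.encode_injective (congrArg Subtype.val hww), ?_⟩)).symm
    rintro ⟨f, hf⟩
    obtain ⟨w, rfl⟩ := (h.mem_code f).1 hf
    exact ⟨w, rfl⟩
  rw [Nat.card_eq_fintype_card, Nat.card_eq_fintype_card, h.card,
    Module.card_eq_pow_finrank (K := ZMod p), ZMod.card] at h1
  exact Nat.pow_right_injective (Fact.out : p.Prime).two_le h1

/-- Summation over the code, for a function that depends on a nonzero codeword `polar Q · w` only
through `Q w`. -/
theorem sum_code {_ : Fintype (D → ZMod p)} {_ : DecidablePred (· ∈ C)} {R : Type*}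
    [CommRing R] (g : (D → ZMod p) → R) (G : ZMod p → R)
    (hg : ∀ w, w ≠ 0 → g (fun d : D => QuadraticMap.polar Q (d : V) w) = G (Q w)) :
    ∑ f with f ∈ C, g f
      = g 0 + (((valueCount Q 0 : ℤ) - 1 : ℤ) : R) * G 0
        + ∑ a with a ≠ 0, ((valueCount Q a : ℤ) : R) * G a := by
  classical
  have h1 : ∑ f with f ∈ C, g f = ∑ w : V, g (fun d : D => QuadraticMap.polar Q (d : V) w) := by
    symm
    refine Finset.sum_bij (fun w _ d => QuadraticMap.polar Q (d : V) w) ?_ ?_ ?_ ?_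
    · intro w _
      simp only [Finset.mem_filter, Finset.mem_univ, true_and]
      exact (h.mem_code _).2 ⟨w, rfl⟩
    · intro w _ w' _ hww
      exact h.encode_injective hww
    · intro f hf
      obtain ⟨w, rfl⟩ := (h.mem_code f).1 (Finset.mem_filter.1 hf).2
      exact ⟨w, Finset.mem_univ _, rfl⟩
    · intro w _
      rfl
  -- The vector `w = 0` also has `Q w = 0` but does not follow the rule `G`; removing it accounts
  -- for the `- 1` in the coefficient of `G 0`.
  have h2 : ∑ w : V, g (fun d : D => QuadraticMap.polar Q (d : V) w)
      = g 0 - G 0 + ∑ w : V, G (Q w) := by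
    rw [← Finset.add_sum_erase _ _ (Finset.mem_univ (0 : V)),
      ← Finset.add_sum_erase _ (fun w => G (Q w)) (Finset.mem_univ (0 : V)), map_zero,
      Finset.sum_congr rfl fun w hw => hg w (Finset.ne_of_mem_erase hw)]
    simp only [QuadraticMap.polar_zero_right]
    change g 0 + _ = _
    ring
  have h3 : ∑ w : V, G (Q w) = ∑ a, ((valueCount Q a : ℤ) : R) * G a := by
    rw [← Finset.sum_fiberwise Finset.univ Q]
    refine Finset.sum_congr rfl fun a _ => ?_
    rw [valueCount, Nat.card_eq_fintype_card, Fintype.card_subtype, Int.cast_natCast,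
      ← nsmul_eq_mul, ← Finset.sum_const]
    exact Finset.sum_congr rfl fun w hw => by rw [(Finset.mem_filter.1 hw).2]
  rw [h1, h2, h3, sum_eq_zero_term_add]
  push_cast
  ring

end IsPolarCode

open Classical in
-- The leading `1` is the zero word, and every other weight lies between `1` and the length.
theorem weightEnumerator_eq_sum {K ι : Type*} [Field K] [Fintype K] [DecidableEq K] [Fintype ι]
    (C : Submodule K (ι → K)) :
    weightEnumerator C = ∑ f with f ∈ C, (X : ℤ[X]) ^ hammingNorm f := by
  have h1 : ∀ i, Polynomial.C (weightCount C i : ℤ) * X ^ i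
      = ∑ f : ι → K with f ∈ C, if hammingNorm f = i then (X : ℤ[X]) ^ hammingNorm f else 0 := by
    intro i
    rw [weightCount, Nat.card_eq_fintype_card, Fintype.card_subtype, ← Finset.sum_filter,
      Finset.filter_filter]
    rw [Finset.sum_congr rfl fun f hf => by rw [(Finset.mem_filter.1 hf).2.2], Finset.sum_const]
    simp
  have h0 : (1 : ℤ[X])
      = ∑ f : ι → K with f ∈ C, if hammingNorm f = 0 then (X : ℤ[X]) ^ hammingNorm f else 0 := by
    simp only [hammingNorm_eq_zero]
    rw [Finset.sum_ite_eq']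
    simp
  rw [weightEnumerator, Finset.sum_congr rfl fun i _ => h1 i]
  nth_rw 1 [h0]
  rw [Finset.sum_comm, ← Finset.sum_add_distrib]
  refine Finset.sum_congr rfl fun f _ => ?_
  rw [Finset.sum_ite_eq]
  have := hammingNorm_le_card_fintype (x := f)
  by_cases hf : hammingNorm f = 0
  · simp [hf]
  · simp [hf, this, Nat.one_le_iff_ne_zero]

end PolarCode

/-! ### Occurrence of both weights, and the enumerators for `c = 0` -/

section PolarCodeEnumerators

variable {p : ℕ} [Fact p.Prime] {V : Type*} [AddCommGroup V] [Module (ZMod p) V] [Fintype V]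
  {Q : QuadraticForm (ZMod p) V} {c : ZMod p} {D : Finset V}
  {C : Submodule (ZMod p) (D → ZMod p)} {ε : ℤ} {m : ℕ}

theorem eq_toNat_of_cast_eq {s : ℕ} {z : ℤ} (h : (s : ℤ) = z) : s = z.toNat := by
  rw [← h, Int.toNat_natCast]

theorem prod_eq_zero_term_mul {M : Type*} [CommMonoid M] (f : ZMod p → M) :
    ∏ ρ, f ρ = f 0 * ∏ ρ with ρ ≠ 0, f ρ := by
  rw [Finset.filter_ne', Finset.mul_prod_erase _ _ (Finset.mem_univ 0)]

theorem card_filter_ne_zero {R : Type*} [CommRing R] :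
    ((Finset.univ.filter fun a : ZMod p => a ≠ 0).card : R) = p - 1 := by
  rw [Finset.filter_ne', Finset.card_erase_of_mem (Finset.mem_univ _), Finset.card_univ, ZMod.card,
    Nat.cast_sub (Fact.out : p.Prime).one_le]
  simp

theorem quadraticChar_zero_sq_sub (hp : p ≠ 2) (b : ZMod p) :
    quadraticChar (ZMod p) (0 ^ 2 - 4 * b) = quadraticChar (ZMod p) (-b) := by
  have h2 : (2 : ZMod p) ≠ 0 := two_ne_zero_of_odd (p := p) hp
  rw [show (0 : ZMod p) ^ 2 - 4 * b = 2 ^ 2 * -b by ring, map_mul, quadraticChar_sq_one' h2,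
    one_mul]

theorem symbolCount_zero {ι : Type*} [Fintype ι] (ρ : ZMod p) :
    symbolCount (0 : ι → ZMod p) ρ = if ρ = 0 then Fintype.card ι else 0 := by
  rw [symbolCount]
  split_ifs with hρ
  · simp [hρ]
  · simp [Ne.symm hρ]

theorem prod_symbolCount_zero {ι : Type*} [Fintype ι] :
    ∏ ρ : ZMod p, (MvPolynomial.X ρ : MvPolynomial (ZMod p) ℤ) ^ symbolCount (0 : ι → ZMod p) ρ
      = MvPolynomial.X 0 ^ Fintype.card ι := by
  rw [prod_eq_zero_term_mul, symbolCount_zero, if_pos rfl, Finset.prod_eq_one, mul_one]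
  intro ρ hρ
  rw [symbolCount_zero, if_neg (by simpa using hρ), pow_zero]

namespace IsPolarCode

section General

variable (h : IsPolarCode Q c D C ε m)
include h

/-- Otherwise at most the zero vector takes the value `a`, whereas the value count exceeds `1`. This
guarantees that both weights occur. -/
theorem exists_value (a : ZMod p) : ∃ w, w ≠ 0 ∧ Q w = a := by
  by_contra! hne
  have h1 : valueCount Q a ≤ 1 := by
    rw [valueCount, Finite.card_le_one_iff_subsingleton]
    refine ⟨fun v w => Subtype.ext ?_⟩
    rw [not_imp_not.1 (hne v) v.2, not_imp_not.1 (hne w) w.2]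
  have h2 : (valueCount Q a : ℤ) ≤ 1 := by exact_mod_cast h1
  rw [h.valueCount_eq, h.pow_eq, h.pow_eq_mul] at h2
  have hp3 : (3 : ℤ) ≤ p := by exact_mod_cast h.three_le
  have h3 := h.three_le_pow
  set P := (p : ℤ) ^ (m - 1)
  have h4 : 0 ≤ (p - 1) * (P - 1) := mul_nonneg (by linarith) (by linarith)
  rcases h.sign with hε | hε <;> rw [hε] at h2 <;> split_ifs at h2 <;> nlinarith

theorem isWeightCode_two {n₁ n₂ : ℕ} (hne : n₁ ≠ n₂)
    (hw : ∀ w, w ≠ 0 → hammingNorm (fun d : D => QuadraticMap.polar Q (d : V) w) = n₁ ∨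
      hammingNorm (fun d : D => QuadraticMap.polar Q (d : V) w) = n₂)
    (h₁ : ∃ w, w ≠ 0 ∧ hammingNorm (fun d : D => QuadraticMap.polar Q (d : V) w) = n₁)
    (h₂ : ∃ w, w ≠ 0 ∧ hammingNorm (fun d : D => QuadraticMap.polar Q (d : V) w) = n₂) :
    IsWeightCode C 2 := by
  have hcount : ∀ i, weightCount C i ≠ 0 ↔ ∃ f ∈ C, hammingNorm f = i := by
    intro i
    rw [weightCount, Nat.card_ne_zero, nonempty_subtype]
    exact and_iff_left Subtype.finite
  have hset : {i : ℕ | 1 ≤ i ∧ i ≤ Fintype.card D ∧ weightCount C i ≠ 0} = {n₁, n₂} := by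
    ext i
    simp only [Set.mem_ofPred_eq, hcount, Set.mem_insert_iff, Set.mem_singleton_iff]
    constructor
    · rintro ⟨hi, _, f, hf, rfl⟩
      obtain ⟨w, rfl⟩ := (h.mem_code f).1 hf
      refine hw w ?_
      rintro rfl
      simp [hammingNorm] at hi
    · have : ∀ w, w ≠ 0 → hammingNorm (fun d : D => QuadraticMap.polar Q (d : V) w) = i →
          1 ≤ i ∧ i ≤ Fintype.card D ∧ ∃ f ∈ C, hammingNorm f = i := by
        rintro w hw0 rfl
        exact ⟨h.hammingNorm_pos hw0, hammingNorm_le_card_fintype, _,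
          (h.mem_code _).2 ⟨w, rfl⟩, rfl⟩
      obtain ⟨w₁, hw₁, h₁⟩ := h₁
      obtain ⟨w₂, hw₂, h₂⟩ := h₂
      rintro (rfl | rfl)
      · exact this w₁ hw₁ h₁
      · exact this w₂ hw₂ h₂
  rw [IsWeightCode, hset, Set.ncard_pair hne]



end General

section ZeroValue

variable (h : IsPolarCode Q 0 D C ε m)
include h

theorem card_support_zero :
    (D.card : ℤ) = (p : ℤ) ^ (2 * m - 1) + ε * (p - 1) * (p : ℤ) ^ (m - 1) - 1 := by
  rw [h.card_support, h.valueCount_eq, if_pos rfl, if_pos rfl]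
  ring

theorem hammingNorm_zero_of_eq {w : V} (hw : w ≠ 0) (hQ : Q w = 0) :
    hammingNorm (fun d : D => QuadraticMap.polar Q (d : V) w) = (p - 1) * p ^ (2 * m - 2) := by
  have h1 := h.hammingNorm_eq hw
  rw [if_pos rfl, hQ, rootCount_zero_zero, if_pos rfl, sub_self, mul_zero, add_zero] at h1
  zify [(Fact.out : p.Prime).one_le]
  exact h1

theorem hammingNorm_zero_of_ne {w : V} (hw : w ≠ 0) (hQ : Q w ≠ 0) :
    (hammingNorm (fun d : D => QuadraticMap.polar Q (d : V) w) : ℤ)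
      = ((p : ℤ) - 1) * ((p : ℤ) ^ (2 * m - 2) + ε * (p : ℤ) ^ (m - 1)) := by
  have h1 := h.hammingNorm_eq hw
  rw [if_pos rfl, rootCount_of_ne_zero h.odd hQ] at h1
  rw [h1]
  simp
  ring

theorem isWeightCode_zero : IsWeightCode C 2 := by
  obtain ⟨w₁, hw₁, hQ₁⟩ := h.exists_value 0
  obtain ⟨w₂, hw₂, hQ₂⟩ := h.exists_value 1
  refine h.isWeightCode_two (n₁ := (p - 1) * p ^ (2 * m - 2))
    (n₂ := (((p : ℤ) - 1) * ((p : ℤ) ^ (2 * m - 2) + ε * (p : ℤ) ^ (m - 1))).toNat) ?_ ?_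
    ⟨w₁, hw₁, h.hammingNorm_zero_of_eq hw₁ hQ₁⟩
    ⟨w₂, hw₂, eq_toNat_of_cast_eq (h.hammingNorm_zero_of_ne hw₂ (by rw [hQ₂]; exact one_ne_zero))⟩
  · rw [← h.hammingNorm_zero_of_eq hw₁ hQ₁,
      ← eq_toNat_of_cast_eq (h.hammingNorm_zero_of_ne hw₂ (by rw [hQ₂]; exact one_ne_zero))]
    zify
    rw [h.hammingNorm_zero_of_ne hw₂ (by rw [hQ₂]; exact one_ne_zero),
      h.hammingNorm_zero_of_eq hw₁ hQ₁]
    push_cast [(Fact.out : p.Prime).one_le]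
    have hp3 : (3 : ℤ) ≤ p := by exact_mod_cast h.three_le
    have h3 := h.three_le_pow
    intro he
    have : ((p : ℤ) - 1) * (ε * (p : ℤ) ^ (m - 1)) = 0 := by linear_combination -he
    rcases mul_eq_zero.1 this with h4 | h4
    · linarith
    · rcases mul_eq_zero.1 h4 with h4 | h4
      · rcases h.sign with h5 | h5 <;> omega
      · linarith
  · intro w hw
    by_cases hQ : Q w = 0
    · exact Or.inl (h.hammingNorm_zero_of_eq hw hQ)
    · exact Or.inr (eq_toNat_of_cast_eq (h.hammingNorm_zero_of_ne hw hQ))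

theorem weightEnumerator_zero :
    weightEnumerator C = 1
      + Polynomial.C ((p : ℤ) ^ (2 * m - 1) + ε * (p - 1) * (p : ℤ) ^ (m - 1) - 1)
        * Polynomial.X ^ ((p - 1) * p ^ (2 * m - 2))
      + Polynomial.C (((p : ℤ) - 1) * ((p : ℤ) ^ (2 * m - 1) - ε * (p : ℤ) ^ (m - 1)))
        * Polynomial.X
          ^ (((p : ℤ) - 1) * ((p : ℤ) ^ (2 * m - 2) + ε * (p : ℤ) ^ (m - 1))).toNat := by
  rw [weightEnumerator_eq_sum, h.sum_code (fun f => (X : ℤ[X]) ^ hammingNorm f)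
    (fun a => if a = 0 then X ^ ((p - 1) * p ^ (2 * m - 2)) else
      X ^ (((p : ℤ) - 1) * ((p : ℤ) ^ (2 * m - 2) + ε * (p : ℤ) ^ (m - 1))).toNat)]
  · have h1 : ∀ a ∈ Finset.univ.filter (fun a : ZMod p => a ≠ 0),
        (((valueCount Q a : ℕ) : ℤ) : ℤ[X]) * (if a = 0 then X ^ ((p - 1) * p ^ (2 * m - 2)) else
          X ^ (((p : ℤ) - 1) * ((p : ℤ) ^ (2 * m - 2) + ε * (p : ℤ) ^ (m - 1))).toNat)
        = Polynomial.C ((p : ℤ) ^ (2 * m - 1) - ε * (p : ℤ) ^ (m - 1)) *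
          X ^ (((p : ℤ) - 1) * ((p : ℤ) ^ (2 * m - 2) + ε * (p : ℤ) ^ (m - 1))).toNat := by
      intro a ha
      have ha : a ≠ 0 := by simpa using ha
      rw [h.valueCount_eq, if_neg ha, if_neg ha, eq_intCast Polynomial.C]
      congr 2
      ring
    rw [Finset.sum_congr rfl h1, Finset.sum_const, nsmul_eq_mul, h.valueCount_eq, if_pos rfl,
      if_pos rfl, hammingNorm_zero, pow_zero, card_filter_ne_zero]
    simp only [eq_intCast]
    push_cast
    ring
  · intro w hw
    split_ifs with hQ
    · rw [h.hammingNorm_zero_of_eq hw hQ]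
    · rw [eq_toNat_of_cast_eq (h.hammingNorm_zero_of_ne hw hQ)]

theorem completeWeightEnumerator_zero :
    completeWeightEnumerator C
      = MvPolynomial.X 0
          ^ ((p : ℤ) ^ (2 * m - 1) + ε * (p - 1) * (p : ℤ) ^ (m - 1) - 1).toNat
        + MvPolynomial.C ((p : ℤ) ^ (2 * m - 1) + ε * (p - 1) * (p : ℤ) ^ (m - 1) - 1)
          * MvPolynomial.X 0
            ^ ((p : ℤ) ^ (2 * m - 2) + ε * (p - 1) * (p : ℤ) ^ (m - 1) - 1).toNat
          * ∏ ρ : ZMod p with ρ ≠ 0, MvPolynomial.X ρ ^ (p ^ (2 * m - 2))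
        + MvPolynomial.C (((p : ℤ) - 1) * ((p : ℤ) ^ (2 * m - 1) - ε * (p : ℤ) ^ (m - 1)))
          * MvPolynomial.X 0 ^ (p ^ (2 * m - 2) - 1)
          * ∏ ρ : ZMod p with ρ ≠ 0,
              MvPolynomial.X ρ ^ ((p : ℤ) ^ (2 * m - 2) + ε * (p : ℤ) ^ (m - 1)).toNat := by
  set M₁ : MvPolynomial (ZMod p) ℤ := MvPolynomial.X 0
      ^ ((p : ℤ) ^ (2 * m - 2) + ε * (p - 1) * (p : ℤ) ^ (m - 1) - 1).toNat
    * ∏ ρ : ZMod p with ρ ≠ 0, MvPolynomial.X ρ ^ (p ^ (2 * m - 2)) with hM₁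
  set M₂ : MvPolynomial (ZMod p) ℤ := MvPolynomial.X 0 ^ (p ^ (2 * m - 2) - 1)
    * ∏ ρ : ZMod p with ρ ≠ 0,
      MvPolynomial.X ρ ^ ((p : ℤ) ^ (2 * m - 2) + ε * (p : ℤ) ^ (m - 1)).toNat with hM₂
  rw [completeWeightEnumerator, h.sum_code (fun f => ∏ ρ, MvPolynomial.X ρ ^ symbolCount f ρ)
    (fun a => if a = 0 then M₁ else M₂)]
  · have h1 : ∀ a ∈ Finset.univ.filter (fun a : ZMod p => a ≠ 0),
        (((valueCount Q a : ℕ) : ℤ) : MvPolynomial (ZMod p) ℤ) * (if a = 0 then M₁ else M₂)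
        = MvPolynomial.C ((p : ℤ) ^ (2 * m - 1) - ε * (p : ℤ) ^ (m - 1)) * M₂ := by
      intro a ha
      have ha : a ≠ 0 := by simpa using ha
      rw [h.valueCount_eq, if_neg ha, if_neg ha, eq_intCast MvPolynomial.C]
      congr 2
      ring
    rw [Finset.sum_congr rfl h1, Finset.sum_const, nsmul_eq_mul, h.valueCount_eq, if_pos rfl,
      if_pos rfl, prod_symbolCount_zero, Fintype.card_coe, eq_toNat_of_cast_eq h.card_support_zero,
      card_filter_ne_zero, hM₁, hM₂]
    simp only [eq_intCast]
    push_cast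
    ring
  · intro w hw
    rw [prod_eq_zero_term_mul]
    split_ifs with hQ
    · rw [hM₁]
      congr 1
      · congr 1
        refine eq_toNat_of_cast_eq ?_
        rw [h.symbolCount_eq hw, hQ, rootCount_zero_zero, if_pos rfl, if_pos ⟨rfl, rfl⟩]
        ring
      · refine Finset.prod_congr rfl fun ρ hρ => ?_
        have hρ : ρ ≠ 0 := by simpa using hρ
        congr 1
        zify
        rw [h.symbolCount_eq hw, hQ, rootCount_zero_left_of_ne hρ, if_neg fun h => hρ h.2]
        push_cast
        ring
    · rw [hM₂]
      congr 1
      · congr 1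
        have : 1 ≤ p ^ (2 * m - 2) := Nat.one_le_pow _ _ (Fact.out : p.Prime).pos
        zify [this]
        rw [h.symbolCount_eq hw, rootCount_of_ne_zero h.odd hQ, if_pos ⟨rfl, rfl⟩]
        simp
      -- For `c = 0` the discriminant is `ρ²`, a nonzero square, so there are two roots.
      · refine Finset.prod_congr rfl fun ρ hρ => ?_
        have hρ : ρ ≠ 0 := by simpa using hρ
        congr 1
        refine eq_toNat_of_cast_eq ?_
        rw [h.symbolCount_eq hw, rootCount_of_ne_zero h.odd hQ, if_neg fun h => hρ h.2, mul_zero,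
          mul_zero, sub_zero, sub_zero, quadraticChar_sq_one' hρ]
        ring

end ZeroValue

end IsPolarCode

end PolarCodeEnumerators

/-! ### The enumerators for nonzero `c` -/

section NonzeroValue

variable {p : ℕ} [Fact p.Prime] {V : Type*} [AddCommGroup V] [Module (ZMod p) V] [Fintype V]
  {Q : QuadraticForm (ZMod p) V} {c : ZMod p} {D : Finset V}
  {C : Submodule (ZMod p) (D → ZMod p)} {ε : ℤ} {m : ℕ}

theorem sum_ne_zero_mul_right {M : Type*} [AddCommMonoid M] {c : ZMod p} (hc : c ≠ 0)
    (f : ZMod p → M) : ∑ a with a ≠ 0, f (a * c) = ∑ a with a ≠ 0, f a := by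
  refine Finset.sum_equiv (Equiv.mulRight₀ c hc) ?_ ?_
  · intro a
    simp [hc]
  · intro a _
    rfl

theorem quadraticChar_generator (hp : p ≠ 2) {g : (ZMod p)ˣ}
    (hg : ∀ x : (ZMod p)ˣ, x ∈ Subgroup.zpowers g) : quadraticChar (ZMod p) (g : ZMod p) = -1 := by
  rcases quadraticChar_dichotomy g.ne_zero with h | h
  · exfalso
    obtain ⟨a, ha⟩ := quadraticChar_exists_neg_one (F := ZMod p) (by rwa [ringChar.eq (ZMod p) p])
    have ha0 : a ≠ 0 := by
      rintro rfl
      simp at ha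
    obtain ⟨j, hj⟩ := Submonoid.mem_powers_iff _ _ |>.1
      (mem_powers_iff_mem_zpowers.2 (hg (Units.mk0 a ha0)))
    have hj' : (g : ZMod p) ^ j = a := by simpa using congrArg Units.val hj
    rw [← hj', map_pow, h, one_pow] at ha
    norm_num at ha
  · exact h

theorem quadraticChar_neg_one_eq_pow (hp : p ≠ 2) :
    quadraticChar (ZMod p) (-1) = (-1) ^ ((p - 1) / 2) := by
  have hpo : p % 2 = 1 := Nat.odd_iff.1 ((Fact.out : p.Prime).odd_of_ne_two hp)
  rw [quadraticChar_neg_one (by rwa [ringChar.eq (ZMod p) p]), ZMod.card,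
    ZMod.χ₄_eq_neg_one_pow hpo]
  congr 1
  omega

theorem sum_range_two_mul {M : Type*} [AddCommMonoid M] (f : ℕ → M) (n : ℕ) :
    ∑ i ∈ Finset.range (2 * n), f i = ∑ j ∈ Finset.range n, (f (2 * j) + f (2 * j + 1)) := by
  induction n with
  | zero => simp
  | succ n ih =>
    rw [mul_add, mul_one, Finset.sum_range_succ, Finset.sum_range_succ, ih,
      Finset.sum_range_succ, add_assoc]

/-- Summation over the nonzero residues along the powers of a primitive root. -/
theorem sum_ne_zero_eq_sum_generator {M : Type*} [AddCommMonoid M] (hp : p ≠ 2) {g : (ZMod p)ˣ}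
    (hg : ∀ x : (ZMod p)ˣ, x ∈ Subgroup.zpowers g) (f : ZMod p → M) :
    ∑ a with a ≠ 0, f a
      = ∑ j ∈ Finset.Icc 1 ((p - 1) / 2), f ((g : ZMod p) ^ (2 * j))
        + ∑ j ∈ Finset.Icc 1 ((p - 1) / 2), f ((g : ZMod p) ^ (2 * j + 1)) := by
  have hpo : p % 2 = 1 := Nat.odd_iff.1 ((Fact.out : p.Prime).odd_of_ne_two hp)
  have hord : orderOf g = 2 * ((p - 1) / 2) := by
    rw [orderOf_eq_card_of_forall_mem_zpowers hg, Nat.card_eq_fintype_card, ZMod.card_units]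
    omega
  -- The factor `g²` shifts the exponents from `0, …, p - 2` to `2, …, p`, matching `2j` and `2j +
  -- 1` for `j` starting at `1`.
  have h1 : ∑ a with a ≠ 0, f a = ∑ u : (ZMod p)ˣ, f ((g ^ 2 * u : (ZMod p)ˣ) : ZMod p) := by
    refine Eq.trans ?_
      (Equiv.sum_comp (Equiv.mulLeft (g ^ 2)) fun u : (ZMod p)ˣ => f (u : ZMod p)).symm
    symm
    refine Finset.sum_bij (fun u _ => (u : ZMod p)) ?_ ?_ ?_ ?_
    · intro u _
      simp
    · intro u _ v _ huv
      exact Units.ext huv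
    · intro a ha
      exact ⟨Units.mk0 a (by simpa using ha), Finset.mem_univ _, rfl⟩
    · intro u _
      rfl
  rw [h1, ← IsCyclic.image_range_orderOf hg, Finset.sum_image, hord, sum_range_two_mul,
    Finset.sum_add_distrib, ← Finset.Ico_add_one_right_eq_Icc, Finset.sum_Ico_eq_sum_range,
    Finset.sum_Ico_eq_sum_range, Nat.add_sub_cancel]
  · congr 1 <;> refine Finset.sum_congr rfl fun j _ => ?_ <;>
      push_cast <;> congr 1 <;> ring
  · rw [Finset.coe_range]
    exact pow_injOn_Iio_orderOf

/-- Twice the summand is `(x + y) + χ(a) (y - x)`, and the quadratic character `χ` sums to zero. -/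
theorem sum_ite_quadraticChar {R : Type*} [CommRing R] [IsDomain R] [CharZero R] (hp : p ≠ 2)
    (x y : R) :
    ∑ a : ZMod p with a ≠ 0, (if quadraticChar (ZMod p) a = -1 then x else y)
      = ((((p : ℤ) - 1) / 2 : ℤ) : R) * (x + y) := by
  obtain ⟨n, hn⟩ := (Fact.out : p.Prime).odd_of_ne_two hp
  have hn' : ((p : ℤ) - 1) / 2 = n := by
    rw [hn]
    push_cast
    simp
  have h0 : ∑ a : ZMod p with a ≠ 0, ((quadraticChar (ZMod p) a : ℤ) : R) = 0 := by
    have h1 := quadraticChar_sum_zero (F := ZMod p) (by rwa [ringChar.eq (ZMod p) p])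
    rw [sum_eq_zero_term_add, MulChar.map_zero, zero_add] at h1
    exact_mod_cast congrArg (Int.cast : ℤ → R) h1
  have h2 : ∀ a ∈ Finset.univ.filter (fun a : ZMod p => a ≠ 0),
      2 * (if quadraticChar (ZMod p) a = -1 then x else y)
        = (x + y) + ((quadraticChar (ZMod p) a : ℤ) : R) * (y - x) := by
    intro a ha
    rcases quadraticChar_dichotomy (F := ZMod p) (by simpa using ha) with h | h
    · rw [h, if_neg (by norm_num)]
      push_cast
      ring
    · rw [h, if_pos rfl]
      push_cast
      ring
  refine mul_left_cancel₀ (two_ne_zero (α := R)) ?_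
  rw [Finset.mul_sum, Finset.sum_congr rfl h2, Finset.sum_add_distrib, ← Finset.sum_mul, h0,
    Finset.sum_const, nsmul_eq_mul, card_filter_ne_zero, hn']
  have : (p : R) = 2 * n + 1 := by exact_mod_cast congrArg (Nat.cast : ℕ → R) hn
  rw [this]
  push_cast
  ring

namespace IsPolarCode

variable (h : IsPolarCode Q c D C ε m)
include h

theorem card_support_of_ne (hc : c ≠ 0) :
    (D.card : ℤ) = (p : ℤ) ^ (2 * m - 1) - ε * (p : ℤ) ^ (m - 1) := by
  rw [h.card_support, h.valueCount_eq, if_neg hc, if_neg hc]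
  ring

/-- The weight is governed by the roots of `s² Q w + c`; for `Q w ≠ 0` there is none exactly when
`-c Q w` is a nonsquare, and for `Q w = 0` there is none because `c ≠ 0`. -/
theorem hammingNorm_of_eq_or (hc : c ≠ 0) {w : V} (hw : w ≠ 0)
    (hQ : Q w = 0 ∨ quadraticChar (ZMod p) (Q w * -c) = -1) :
    hammingNorm (fun d : D => QuadraticMap.polar Q (d : V) w) = (p - 1) * p ^ (2 * m - 2) := by
  have h1 := h.hammingNorm_eq hw
  have h2 : rootCount (Q w) 0 c = 0 := by
    rcases hQ with hQ | hQ
    · rw [hQ, rootCount_zero_zero, if_neg hc]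
    · have hQ0 : Q w ≠ 0 := by
        intro h0
        simp [h0] at hQ
      have h3 := rootCount_of_ne_zero h.odd hQ0 0 c
      rw [quadraticChar_zero_sq_sub h.odd, ← mul_neg, hQ] at h3
      omega
  rw [if_neg hc, h2, Nat.cast_zero, sub_self, mul_zero, add_zero] at h1
  zify [(Fact.out : p.Prime).one_le]
  exact h1

theorem hammingNorm_of_quadraticChar_eq_one (hc : c ≠ 0) {w : V} (hw : w ≠ 0)
    (hQ : quadraticChar (ZMod p) (Q w * -c) = 1) :
    (hammingNorm (fun d : D => QuadraticMap.polar Q (d : V) w) : ℤ)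
      = ((p : ℤ) - 1) * (p : ℤ) ^ (2 * m - 2) - ε * 2 * (p : ℤ) ^ (m - 1) := by
  have hQ0 : Q w ≠ 0 := by
    intro h0
    simp [h0] at hQ
  rw [h.hammingNorm_eq hw, if_neg hc, rootCount_of_ne_zero h.odd hQ0,
    quadraticChar_zero_sq_sub h.odd, ← mul_neg, hQ]
  ring

theorem isWeightCode_of_ne (hc : c ≠ 0) : IsWeightCode C 2 := by
  obtain ⟨w₁, hw₁, hQ₁⟩ := h.exists_value 0
  -- The value `-c` makes `-c Q w₂` the square `c²`, so the second weight occurs.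
  obtain ⟨w₂, hw₂, hQ₂⟩ := h.exists_value (-c)
  have hQ₂' : quadraticChar (ZMod p) (Q w₂ * -c) = 1 := by
    rw [hQ₂, ← sq, quadraticChar_sq_one' (neg_ne_zero.2 hc)]
  have h₂ := h.hammingNorm_of_quadraticChar_eq_one hc hw₂ hQ₂'
  refine h.isWeightCode_two (n₁ := (p - 1) * p ^ (2 * m - 2))
    (n₂ := hammingNorm (fun d : D => QuadraticMap.polar Q (d : V) w₂)) ?_ ?_
    ⟨w₁, hw₁, h.hammingNorm_of_eq_or hc hw₁ (Or.inl hQ₁)⟩ ⟨w₂, hw₂, rfl⟩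
  · zify [(Fact.out : p.Prime).one_le]
    rw [h₂]
    have h3 := h.three_le_pow
    rcases h.sign with h5 | h5 <;> rw [h5] <;> intro he <;> linarith
  · intro w hw
    by_cases hQ : Q w = 0
    · exact Or.inl (h.hammingNorm_of_eq_or hc hw (Or.inl hQ))
    · rcases quadraticChar_dichotomy (mul_ne_zero hQ (neg_ne_zero.2 hc)) with h1 | h1
      · right
        zify
        rw [h₂, h.hammingNorm_of_quadraticChar_eq_one hc hw h1]
      · exact Or.inl (h.hammingNorm_of_eq_or hc hw (Or.inr h1))

theorem weightEnumerator_of_ne (hc : c ≠ 0) :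
    weightEnumerator C = 1
      + Polynomial.C (((p : ℤ) + 1) / 2 * (p : ℤ) ^ (2 * m - 1)
          + ((p : ℤ) - 1) / 2 * ε * (p : ℤ) ^ (m - 1) - 1)
        * Polynomial.X ^ ((p - 1) * p ^ (2 * m - 2))
      + Polynomial.C (((p : ℤ) - 1) / 2 * ((p : ℤ) ^ (2 * m - 1) - ε * (p : ℤ) ^ (m - 1)))
        * Polynomial.X
          ^ (((p : ℤ) - 1) * (p : ℤ) ^ (2 * m - 2) - ε * 2 * (p : ℤ) ^ (m - 1)).toNat := by
  set M₁ : ℤ[X] := X ^ ((p - 1) * p ^ (2 * m - 2)) with hM₁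
  set M₂ : ℤ[X] :=
    X ^ (((p : ℤ) - 1) * (p : ℤ) ^ (2 * m - 2) - ε * 2 * (p : ℤ) ^ (m - 1)).toNat with hM₂
  rw [weightEnumerator_eq_sum, h.sum_code (fun f => (X : ℤ[X]) ^ hammingNorm f)
    (fun a => if a = 0 then M₁ else if quadraticChar (ZMod p) (a * -c) = -1 then M₁ else M₂)]
  · have h1 : ∀ a ∈ Finset.univ.filter (fun a : ZMod p => a ≠ 0),
        (((valueCount Q a : ℕ) : ℤ) : ℤ[X]) *
          (if a = 0 then M₁ else if quadraticChar (ZMod p) (a * -c) = -1 then M₁ else M₂)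
        = (((p : ℤ) ^ (2 * m - 1) - ε * (p : ℤ) ^ (m - 1) : ℤ) : ℤ[X]) *
          if quadraticChar (ZMod p) (a * -c) = -1 then M₁ else M₂ := by
      intro a ha
      have ha : a ≠ 0 := by simpa using ha
      rw [h.valueCount_eq, if_neg ha, if_neg ha]
      congr 2
      ring
    rw [Finset.sum_congr rfl h1, ← Finset.mul_sum, sum_ne_zero_mul_right (neg_ne_zero.2 hc)
      fun a => if quadraticChar (ZMod p) a = -1 then M₁ else M₂, sum_ite_quadraticChar h.odd,
      h.valueCount_eq, if_pos rfl, if_pos rfl, hammingNorm_zero, pow_zero]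
    obtain ⟨n, hn⟩ := (Fact.out : p.Prime).odd_of_ne_two h.odd
    have hn0 : (p : ℤ) = 2 * n + 1 := by exact_mod_cast hn
    have hn1 : ((p : ℤ) - 1) / 2 = n := by omega
    have hn2 : ((p : ℤ) + 1) / 2 = n + 1 := by omega
    rw [hn1, hn2]
    have hn3 : (p : ℤ[X]) = 2 * n + 1 := by exact_mod_cast congrArg (Nat.cast : ℕ → ℤ[X]) hn
    generalize (p : ℤ) ^ (2 * m - 1) = x
    generalize (p : ℤ) ^ (m - 1) = y
    simp only [eq_intCast]
    push_cast
    rw [hn3]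
    ring
  · intro w hw
    split_ifs with hQ hQ'
    · rw [h.hammingNorm_of_eq_or hc hw (Or.inl hQ)]
    · rw [h.hammingNorm_of_eq_or hc hw (Or.inr hQ')]
    · rw [hM₂, eq_toNat_of_cast_eq (h.hammingNorm_of_quadraticChar_eq_one hc hw
        ((quadraticChar_dichotomy (mul_ne_zero hQ (neg_ne_zero.2 hc))).resolve_right hQ'))]

/-- The complete weight enumerator with the codewords grouped by the product of `Q w` and `c`. -/
theorem completeWeightEnumerator_eq_sum (hc : c ≠ 0) :
    completeWeightEnumerator C
      = MvPolynomial.X 0 ^ ((p : ℤ) ^ (2 * m - 1) - ε * (p : ℤ) ^ (m - 1)).toNat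
        + MvPolynomial.C ((p : ℤ) ^ (2 * m - 1) + ε * (p - 1) * (p : ℤ) ^ (m - 1) - 1)
          * MvPolynomial.X 0 ^ ((p : ℤ) ^ (2 * m - 2) - ε * (p : ℤ) ^ (m - 1)).toNat
          * ∏ ρ : ZMod p with ρ ≠ 0, MvPolynomial.X ρ ^ (p ^ (2 * m - 2))
        + MvPolynomial.C ((p : ℤ) ^ (2 * m - 1) - ε * (p : ℤ) ^ (m - 1))
          * ∑ b : ZMod p with b ≠ 0, ∏ ρ : ZMod p, MvPolynomial.X ρ
            ^ ((p : ℤ) ^ (2 * m - 2) + ε * (p : ℤ) ^ (m - 1)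
              * quadraticChar (ZMod p) (ρ ^ 2 - 4 * b)).toNat := by
  set H : ZMod p → MvPolynomial (ZMod p) ℤ := fun b => ∏ ρ : ZMod p, MvPolynomial.X ρ
    ^ ((p : ℤ) ^ (2 * m - 2) + ε * (p : ℤ) ^ (m - 1)
      * quadraticChar (ZMod p) (ρ ^ 2 - 4 * b)).toNat with hH
  set M₁ : MvPolynomial (ZMod p) ℤ := MvPolynomial.X 0
      ^ ((p : ℤ) ^ (2 * m - 2) - ε * (p : ℤ) ^ (m - 1)).toNat
    * ∏ ρ : ZMod p with ρ ≠ 0, MvPolynomial.X ρ ^ (p ^ (2 * m - 2)) with hM₁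
  rw [completeWeightEnumerator, h.sum_code (fun f => ∏ ρ, MvPolynomial.X ρ ^ symbolCount f ρ)
    (fun a => if a = 0 then M₁ else H (a * c))]
  · have h1 : ∀ a ∈ Finset.univ.filter (fun a : ZMod p => a ≠ 0),
        (((valueCount Q a : ℕ) : ℤ) : MvPolynomial (ZMod p) ℤ) * (if a = 0 then M₁ else H (a * c))
        = MvPolynomial.C ((p : ℤ) ^ (2 * m - 1) - ε * (p : ℤ) ^ (m - 1)) * H (a * c) := by
      intro a ha
      have ha : a ≠ 0 := by simpa using ha
      rw [h.valueCount_eq, if_neg ha, if_neg ha, eq_intCast MvPolynomial.C]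
      congr 2
      ring
    -- All nonzero values of `Q` are equally frequent, so substituting `b = a c` eliminates `c` from
    -- the enumerator.
    rw [Finset.sum_congr rfl h1, ← Finset.mul_sum, sum_ne_zero_mul_right hc H, h.valueCount_eq,
      if_pos rfl, if_pos rfl, prod_symbolCount_zero, Fintype.card_coe,
      eq_toNat_of_cast_eq (h.card_support_of_ne hc), hM₁]
    simp only [eq_intCast]
    push_cast
    ring
  · intro w hw
    split_ifs with hQ
    · rw [prod_eq_zero_term_mul, hM₁]
      congr 1
      · congr 1
        refine eq_toNat_of_cast_eq ?_
        rw [h.symbolCount_eq hw, hQ, rootCount_zero_zero, if_neg hc, if_neg fun h => hc h.1]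
        push_cast
        ring
      · refine Finset.prod_congr rfl fun ρ hρ => ?_
        have hρ : ρ ≠ 0 := by simpa using hρ
        congr 1
        zify
        rw [h.symbolCount_eq hw, hQ, rootCount_zero_left_of_ne hρ, if_neg fun h => hc h.1]
        push_cast
        ring
    · refine Finset.prod_congr rfl fun ρ _ => ?_
      congr 1
      refine eq_toNat_of_cast_eq ?_
      rw [h.symbolCount_eq hw, rootCount_of_ne_zero h.odd hQ, if_neg fun h => hc h.1]
      ring

end IsPolarCode

theorem prod_eq_three_terms_mul {M : Type*} [CommMonoid M] {r : ZMod p} (hp : p ≠ 2) (hr : r ≠ 0)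
    (f : ZMod p → M) :
    ∏ ρ, f ρ = f 0 * f r * f (-r) * ∏ ρ with ρ ≠ 0 ∧ ρ ≠ r ∧ ρ ≠ -r, f ρ := by
  have h2 : (2 : ZMod p) ≠ 0 := two_ne_zero_of_odd (p := p) hp
  have hrr : r ≠ -r := by
    intro h
    have : 2 * r = 0 := by linear_combination h
    exact hr ((mul_eq_zero.1 this).resolve_left h2)
  have h1 : (Finset.univ : Finset (ZMod p))
      = insert 0 (insert r (insert (-r) (Finset.univ.filter
        fun ρ : ZMod p => ρ ≠ 0 ∧ ρ ≠ r ∧ ρ ≠ -r))) := by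
    ext ρ
    simp only [Finset.mem_univ, Finset.mem_insert, Finset.mem_filter, true_and, true_iff]
    tauto
  conv_lhs => rw [h1]
  rw [Finset.prod_insert, Finset.prod_insert, Finset.prod_insert, mul_assoc, mul_assoc]
  · simp
  · simp [hrr]
  · simp [hr, Ne.symm hr]

section Exponents

variable {R : Type*} [CommRing R] (X : ZMod p → R) {q d : ℤ} {g : (ZMod p)ˣ}

/-- The discriminant `ρ² - 4 g^(2j)` vanishes at `ρ = ± 2 g^j`, and at `ρ = 0` its character is that
of `-1`, which turns `ε` into `ε'`. -/
theorem prod_pow_quadraticChar_even (hp : p ≠ 2) (ε' : ℤ)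
    (hε' : ε' = ε * quadraticChar (ZMod p) (-1)) (j : ℕ) :
    ∏ ρ : ZMod p, X ρ ^ (((p ^ (2 * m - 2) : ℕ) : ℤ) + ε * d
        * quadraticChar (ZMod p) (ρ ^ 2 - 4 * (g : ZMod p) ^ (2 * j))).toNat
      = X 0 ^ (((p ^ (2 * m - 2) : ℕ) : ℤ) + ε' * d).toNat
        * X (2 * (g : ZMod p) ^ j) ^ (p ^ (2 * m - 2))
        * X (-(2 * (g : ZMod p) ^ j)) ^ (p ^ (2 * m - 2))
        * ∏ ρ : ZMod p with
              ρ ≠ 0 ∧ ρ ≠ 2 * (g : ZMod p) ^ j ∧ ρ ≠ -(2 * (g : ZMod p) ^ j),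
            X ρ ^ (((p ^ (2 * m - 2) : ℕ) : ℤ) + ε * d
              * quadraticChar (ZMod p) (ρ ^ 2 - 4 * (g : ZMod p) ^ (2 * j))).toNat := by
  have h2 : (2 : ZMod p) ≠ 0 := two_ne_zero_of_odd (p := p) hp
  have hgj : (g : ZMod p) ^ j ≠ 0 := pow_ne_zero _ g.ne_zero
  rw [prod_eq_three_terms_mul hp (mul_ne_zero h2 hgj)]
  have h1 : ((2 * (g : ZMod p) ^ j) ^ 2 - 4 * (g : ZMod p) ^ (2 * j)) = 0 := by ring
  have h3 : ((-(2 * (g : ZMod p) ^ j)) ^ 2 - 4 * (g : ZMod p) ^ (2 * j)) = 0 := by ring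
  have h4 : quadraticChar (ZMod p) (0 ^ 2 - 4 * (g : ZMod p) ^ (2 * j))
      = quadraticChar (ZMod p) (-1) := by
    rw [quadraticChar_zero_sq_sub hp, neg_eq_neg_one_mul, map_mul, mul_comm 2 j, pow_mul,
      quadraticChar_sq_one' hgj, mul_one]
  rw [h1, h3, h4, MulChar.map_zero, mul_zero, add_zero, Int.toNat_natCast, hε', mul_right_comm ε]

/-- At `ρ = 0` the nonsquare `g^(2j+1)` reverses the sign of the character, hence `-ε'`. Only this
term is split off: `4 g^(2j+1)` is a nonsquare, so the discriminant never vanishes. -/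
theorem prod_pow_quadraticChar_odd (hp : p ≠ 2)
    (hg : ∀ x : (ZMod p)ˣ, x ∈ Subgroup.zpowers g) (ε' : ℤ)
    (hε' : ε' = ε * quadraticChar (ZMod p) (-1)) (j : ℕ) :
    ∏ ρ : ZMod p, X ρ ^ (q + ε * d
        * quadraticChar (ZMod p) (ρ ^ 2 - 4 * (g : ZMod p) ^ (2 * j + 1))).toNat
      = X 0 ^ (q - ε' * d).toNat
        * ∏ ρ : ZMod p with ρ ≠ 0, X ρ ^ (q + ε * d
            * quadraticChar (ZMod p) (ρ ^ 2 - 4 * (g : ZMod p) ^ (2 * j + 1))).toNat := by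
  rw [prod_eq_zero_term_mul]
  have hgj : (g : ZMod p) ^ j ≠ 0 := pow_ne_zero _ g.ne_zero
  have h4 : quadraticChar (ZMod p) (0 ^ 2 - 4 * (g : ZMod p) ^ (2 * j + 1))
      = -quadraticChar (ZMod p) (-1) := by
    rw [quadraticChar_zero_sq_sub hp, neg_eq_neg_one_mul, map_mul, pow_succ, map_mul, mul_comm 2 j,
      pow_mul, quadraticChar_sq_one' hgj, quadraticChar_generator hp hg]
    ring
  rw [h4, hε', mul_neg, ← sub_eq_add_neg, mul_right_comm ε]

end Exponents

end NonzeroValue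

/-! ### Application to the defining set, and the main theorem -/

theorem isPolarCode_codeOf {p : ℕ} [Fact p.Prime] (hp : p ≠ 2) {m k l : ℕ}
    {F : Type*} [Field F] [Fintype F] [DecidableEq F] [Algebra (ZMod p) F]
    (hF : Fintype.card F = p ^ m)
    (hv : 2 * padicValNat 2 m
      = padicValNat 2 (Nat.gcd k m) + padicValNat 2 (Nat.gcd l m) + 1) (c : ZMod p) :
    IsPolarCode (tracePowProdForm p F k l) c (definingSet p k l c)
      (codeOf p (definingSet p k l c : Finset (F × F))) ((-1) ^ ((p - 1) * m / 4)) m := by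
  have hm : m ≠ 0 := by
    rintro rfl
    simp at hv
  have hle : ∀ i, padicValNat 2 (Nat.gcd i m) ≤ padicValNat 2 m := fun i =>
    (padicValNat_dvd_iff_le hm).1 (pow_padicValNat_dvd.trans (Nat.gcd_dvd_right i m))
  -- The deficits of the two valuations from that of `m` are nonnegative and sum to `1`.
  have hkl : (padicValNat 2 (Nat.gcd k m) = padicValNat 2 m ∧
      padicValNat 2 (Nat.gcd l m) + 1 = padicValNat 2 m) ∨
      (padicValNat 2 (Nat.gcd l m) = padicValNat 2 m ∧
        padicValNat 2 (Nat.gcd k m) + 1 = padicValNat 2 m) := by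
    have h1 := hle k
    have h2 := hle l
    omega
  have hm2 : 2 ≤ m := by
    have h1 : 1 ≤ padicValNat 2 m := by omega
    have h2 : 2 ∣ m := dvd_of_one_le_padicValNat h1
    exact Nat.le_of_dvd (Nat.pos_of_ne_zero hm) h2
  have hk := polar_tracePowForm_nondegenerate_of_padicValNat (F := F) (k := k) hp hm hF (by tauto)
  have hl := polar_tracePowForm_nondegenerate_of_padicValNat (F := F) (k := l) hp hm hF (by tauto)
  have hψ := ZMod.isPrimitive_stdAddChar p
  have hcard : Fintype.card (F × F) = p ^ (2 * m) := by
    rw [Fintype.card_prod, hF, two_mul, pow_add]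
  have hT : ∀ t : ZMod p, t ≠ 0 → ∑ v, ZMod.stdAddChar (t * tracePowProdForm p F k l v)
      = (((-1) ^ ((p - 1) * m / 4) : ℤ) : ℂ) * (p : ℂ) ^ m := by
    intro t ht
    rw [sum_addChar_tracePowProdForm]
    rcases hkl with ⟨h1, h2⟩ | ⟨h1, h2⟩
    · exact sum_addChar_tracePowForm_mul hψ hp hm hF h1 h2 ht
    · rw [mul_comm]
      exact sum_addChar_tracePowForm_mul hψ hp hm hF h1 h2 ht
  have hp0 : (p : ℤ) ≠ 0 := by exact_mod_cast (Fact.out : p.Prime).ne_zero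
  have hpow : ∀ n i, i ≤ n → (p : ℤ) ^ n = (p : ℤ) ^ i * (p : ℤ) ^ (n - i) := fun n i hi => by
    rw [← pow_add, Nat.add_sub_cancel' hi]
  refine ⟨hp, neg_one_pow_eq_or ℤ _, hm2, hcard, ?_, mem_codeOf_iff hk hl _, ?_, ?_⟩
  · intro v
    rw [definingSet, Finset.mem_filter, tracePowProdForm_apply]
    exact and_iff_right (Finset.mem_univ v)
  · intro a
    refine mul_left_cancel₀ hp0 ?_
    rw [mul_valueCount hψ hcard hT, hpow (2 * m) 1 (by omega), hpow m 1 (by omega)]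
    ring
  · intro w hw a ρ
    refine mul_left_cancel₀ (pow_ne_zero 2 hp0) ?_
    rw [mul_sliceCount hψ hcard hT (exists_polar_tracePowProdForm_ne_zero hk hl hw),
      hpow (2 * m) 2 (by omega), hpow (m + 1) 2 (by omega), show m + 1 - 2 = m - 1 by omega]
    ring

/-- For even `m` the exponents differ by `(p - 1)/2`, and `(-1)^((p-1)/2)` is the character of `-1`.
-/
theorem neg_one_pow_mul_quadraticChar_neg_one {p : ℕ} [Fact p.Prime] (hp : p ≠ 2) {m : ℕ}
    (hm : Even m) : (-1 : ℤ) ^ ((p - 1) * (m + 2) / 4)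
      = (-1) ^ ((p - 1) * m / 4) * quadraticChar (ZMod p) (-1) := by
  obtain ⟨a, ha⟩ := (Fact.out : p.Prime).odd_of_ne_two hp
  obtain ⟨n, rfl⟩ := hm
  rw [quadraticChar_neg_one_eq_pow hp, ← pow_add, show p - 1 = 2 * a by omega,
    show 2 * a * (n + n + 2) = 4 * (a * n + a) by ring, show 2 * a * (n + n) = 4 * (a * n) by ring]
  congr 1
  omega


/-- Here `F` is the field with `p ^ m` elements and `ε = (-1)^((p-1)m/4)`. The hypothesis forces
`m` to be even, so every division is exact, no subtraction of natural numbers truncates, and every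
integer to which `toNat` is applied is nonnegative. -/
theorem theorem2 (p : ℕ) [Fact p.Prime] (hp : p ≠ 2) (m k l : ℕ)
    (F : Type*) [Field F] [Fintype F] [DecidableEq F] [Algebra (ZMod p) F]
    (hF : Fintype.card F = p ^ m)
    (hv : 2 * padicValNat 2 m
      = padicValNat 2 (Nat.gcd k m) + padicValNat 2 (Nat.gcd l m) + 1)
    (ε : ℤ) (hε : ε = (-1) ^ ((p - 1) * m / 4)) :
    -- the case `c = 0`
    ((((definingSet p k l 0 : Finset (F × F)).card : ℤ)
          = (p : ℤ) ^ (2 * m - 1) + ε * (p - 1) * (p : ℤ) ^ (m - 1) - 1) ∧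
      Module.finrank (ZMod p) (codeOf p (definingSet p k l 0 : Finset (F × F))) = 2 * m ∧
      IsWeightCode (codeOf p (definingSet p k l 0 : Finset (F × F))) 2 ∧
      weightEnumerator (codeOf p (definingSet p k l 0 : Finset (F × F)))
        = 1
          + Polynomial.C ((p : ℤ) ^ (2 * m - 1) + ε * (p - 1) * (p : ℤ) ^ (m - 1) - 1)
            * Polynomial.X ^ ((p - 1) * p ^ (2 * m - 2))
          + Polynomial.C (((p : ℤ) - 1) * ((p : ℤ) ^ (2 * m - 1) - ε * (p : ℤ) ^ (m - 1)))
            * Polynomial.X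
              ^ (((p : ℤ) - 1) * ((p : ℤ) ^ (2 * m - 2) + ε * (p : ℤ) ^ (m - 1))).toNat ∧
      completeWeightEnumerator (codeOf p (definingSet p k l 0 : Finset (F × F)))
        = MvPolynomial.X 0
            ^ ((p : ℤ) ^ (2 * m - 1) + ε * (p - 1) * (p : ℤ) ^ (m - 1) - 1).toNat
          + MvPolynomial.C ((p : ℤ) ^ (2 * m - 1) + ε * (p - 1) * (p : ℤ) ^ (m - 1) - 1)
            * MvPolynomial.X 0
              ^ ((p : ℤ) ^ (2 * m - 2) + ε * (p - 1) * (p : ℤ) ^ (m - 1) - 1).toNat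
            * ∏ ρ : ZMod p with ρ ≠ 0, MvPolynomial.X ρ ^ (p ^ (2 * m - 2))
          + MvPolynomial.C (((p : ℤ) - 1) * ((p : ℤ) ^ (2 * m - 1) - ε * (p : ℤ) ^ (m - 1)))
            * MvPolynomial.X 0 ^ (p ^ (2 * m - 2) - 1)
            * ∏ ρ : ZMod p with ρ ≠ 0,
                MvPolynomial.X ρ ^ ((p : ℤ) ^ (2 * m - 2) + ε * (p : ℤ) ^ (m - 1)).toNat) ∧
    -- the case of nonzero `c`
    (∀ c : ZMod p, c ≠ 0 →
      (((definingSet p k l c : Finset (F × F)).card : ℤ)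
          = (p : ℤ) ^ (2 * m - 1) - ε * (p : ℤ) ^ (m - 1)) ∧
      Module.finrank (ZMod p) (codeOf p (definingSet p k l c : Finset (F × F))) = 2 * m ∧
      IsWeightCode (codeOf p (definingSet p k l c : Finset (F × F))) 2 ∧
      weightEnumerator (codeOf p (definingSet p k l c : Finset (F × F)))
        = 1
          + Polynomial.C (((p : ℤ) + 1) / 2 * (p : ℤ) ^ (2 * m - 1)
              + ((p : ℤ) - 1) / 2 * ε * (p : ℤ) ^ (m - 1) - 1)
            * Polynomial.X ^ ((p - 1) * p ^ (2 * m - 2))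
          + Polynomial.C (((p : ℤ) - 1) / 2
              * ((p : ℤ) ^ (2 * m - 1) - ε * (p : ℤ) ^ (m - 1)))
            * Polynomial.X
              ^ (((p : ℤ) - 1) * (p : ℤ) ^ (2 * m - 2) - ε * 2 * (p : ℤ) ^ (m - 1)).toNat ∧
      ∀ g : (ZMod p)ˣ, (∀ x : (ZMod p)ˣ, x ∈ Subgroup.zpowers g) →
        completeWeightEnumerator (codeOf p (definingSet p k l c : Finset (F × F)))
          = MvPolynomial.X 0 ^ ((p : ℤ) ^ (2 * m - 1) - ε * (p : ℤ) ^ (m - 1)).toNat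
            + MvPolynomial.C ((p : ℤ) ^ (2 * m - 1) + ε * (p - 1) * (p : ℤ) ^ (m - 1) - 1)
              * MvPolynomial.X 0 ^ ((p : ℤ) ^ (2 * m - 2) - ε * (p : ℤ) ^ (m - 1)).toNat
              * ∏ ρ : ZMod p with ρ ≠ 0, MvPolynomial.X ρ ^ (p ^ (2 * m - 2))
            + MvPolynomial.C ((p : ℤ) ^ (2 * m - 1) - ε * (p : ℤ) ^ (m - 1))
              * (∑ j ∈ Finset.Icc 1 ((p - 1) / 2),
                  MvPolynomial.X 0
                    ^ ((p : ℤ) ^ (2 * m - 2)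
                        + (-1) ^ ((p - 1) * (m + 2) / 4) * (p : ℤ) ^ (m - 1)).toNat
                  * MvPolynomial.X (2 * (g : ZMod p) ^ j) ^ (p ^ (2 * m - 2))
                  * MvPolynomial.X (-(2 * (g : ZMod p) ^ j)) ^ (p ^ (2 * m - 2))
                  * ∏ ρ : ZMod p with
                        ρ ≠ 0 ∧ ρ ≠ 2 * (g : ZMod p) ^ j ∧ ρ ≠ -(2 * (g : ZMod p) ^ j),
                      MvPolynomial.X ρ
                        ^ ((p : ℤ) ^ (2 * m - 2) + ε * (p : ℤ) ^ (m - 1)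
                            * quadraticChar (ZMod p)
                                (ρ ^ 2 - 4 * (g : ZMod p) ^ (2 * j))).toNat
                + ∑ j ∈ Finset.Icc 1 ((p - 1) / 2),
                  MvPolynomial.X 0
                    ^ ((p : ℤ) ^ (2 * m - 2)
                        - (-1) ^ ((p - 1) * (m + 2) / 4) * (p : ℤ) ^ (m - 1)).toNat
                  * ∏ ρ : ZMod p with ρ ≠ 0,
                      MvPolynomial.X ρ
                        ^ ((p : ℤ) ^ (2 * m - 2) + ε * (p : ℤ) ^ (m - 1)
                            * quadraticChar (ZMod p)
                                (ρ ^ 2 - 4 * (g : ZMod p) ^ (2 * j + 1))).toNat)) := by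
  subst hε
  have h := fun c => isPolarCode_codeOf (F := F) hp hF hv c
  refine ⟨⟨(h 0).card_support_zero, (h 0).finrank_eq, (h 0).isWeightCode_zero,
    (h 0).weightEnumerator_zero, (h 0).completeWeightEnumerator_zero⟩, fun c hc =>
    ⟨(h c).card_support_of_ne hc, (h c).finrank_eq, (h c).isWeightCode_of_ne hc,
      (h c).weightEnumerator_of_ne hc, fun g hg => ?_⟩⟩
  have hm : Even m := by
    have h1 : 1 ≤ padicValNat 2 m := by omega
    exact even_iff_two_dvd.2 (dvd_of_one_le_padicValNat h1)
  have hε' := neg_one_pow_mul_quadraticChar_neg_one hp hm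
  rw [(h c).completeWeightEnumerator_eq_sum hc, sum_ne_zero_eq_sum_generator hp hg]
  congr 2
  congr 1
  · refine Finset.sum_congr rfl fun j _ => ?_
    have := prod_pow_quadraticChar_even (m := m) (g := g) (d := (p : ℤ) ^ (m - 1))
      (MvPolynomial.X (R := ℤ)) hp _ hε' j
    push_cast at this
    exact this
  · exact Finset.sum_congr rfl fun j _ => prod_pow_quadraticChar_odd _ hp hg _ hε' j
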